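/- Let $1\le n$ and $d>n+2$. Setting. Let $X\in\mathbb R^d$ be a random vector with finite second moment and $\Sigma=\mathbb E[XX^\top]\succ 0$, and let $Y=X^\top\theta_\star+\epsilon$ with $\mathbb E[\epsilon\mid X]=0$ and $\mathbb E[\epsilon^2\mid X]=\sigma^2$. Given $n$ i.i.d. copies $(X_i,Y_i)$ of $(X,Y)$, a linear prediction rule is a predictor $\hat f(x)=\sum_{i=1}^n l_i(x)Y_i$, where the weights $l_i(x)$ are measurable functions of $x$, of $X_1,\dots,X_n$ and of a source of randomness independent of the data. Put $R(f)=\mathbb E[(Y-f(X))^2]$ and $\mathcal E_{\sigma^2}(\hat f)=\mathbb E[R(\hat f)]-R(f_\star)$ with $f_\star(x)=x^\top\theta_\star$, the expectation being over the training set and the randomness of the rule. Let $\nu$ be a probability distribution on $\mathbb R^d$ with finite second moment $H=\mathbb E_{\theta\sim\nu}[\theta\theta^\top]$, and set $\Sigma_H=H^{1/2}\Sigma H^{1/2}$. The optimal averaged excess risk is $$\bar{\mathcal E}(\Sigma_H;\sigma^2)=\inf_{\hat f}\ \mathbb E_{\theta_\star\sim\nu}\big[\mathcal E_{\sigma^2}(\hat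 f)\big],$$ the infimum being over all linear prediction rules. Let $\mathrm{df}_1(S;\lambda)=\mathrm{Tr}\big(S(S+\lambda I)^{-1}\big)$, with $\lambda\,\mathrm{df}_1(S;\lambda)=0$ for $\lambda=0$, and let $\lambda_1(S)\ge\dots\ge\lambda_d(S)$ be the eigenvalues of $S$. Theorem. Assume that $Z=\Sigma^{-1/2}X$ is such that $Z/\|Z\|_2$ is uniformly distributed on the unit sphere $\mathbb S^{d-1}$. Then there is a number $\sigma_0^2\ge 0$, depending only on $n$ and $\Sigma_H$, such that $$\underline\lambda_0\,\mathrm{df}_1(\Sigma_H;\underline\lambda_0)\ \le\ \bar{\mathcal E}(\Sigma_H;0)\ \le\ \bar\lambda_0\,\mathrm{df}_1(\Sigma_H;\bar\lambda_0),\qquad \underline\lambda_0=\frac{\sigma_0^2}{n},\quad \bar\lambda_0=\frac{3\,\mathrm{Tr}(\Sigma_H)}{n},$$ and such that, for every integer $k$ with $n+2<k\le d$ and $\lambda_k(\Sigma_H)>0$, $$\sigma_0^2\ \ge\ (k-1)(k-n-2)\Big(\sum_{j=2}^k\lambda_j(\Sigma_H)^{-1}\Big)^{-1}.$$ Moreover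 $\sigma_0^2>0$ whenever $\mathrm{rank}(\Sigma_H)>n$ (in particular when $H\succ 0$). -/

import Mathlib

open MeasureTheory ProbabilityTheory
open scoped ENNReal MatrixOrder

noncomputable section

namespace LinearPrediction

/-- The space of covariates, with the Euclidean norm. -/
abbrev Vec (d : ℕ) := EuclideanSpace ℝ (Fin d)

/-- The matrix `E[X Xᵀ]` of a random vector `X` with law `μ`. -/
def secondMoment {d : ℕ} (μ : Measure (Vec d)) : Matrix (Fin d) (Fin d) ℝ :=
  Matrix.of fun i j => ∫ x, x i * x j ∂μ

/-- `noise x` is the conditional law of the noise `ε` given `X = x`: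
`E[ε | X] = 0` and `E[ε² | X] = σ²`, where `X` has law `P`. -/
structure IsNoise {d : ℕ} (P : Measure (Vec d)) (noise : Kernel (Vec d) ℝ) (σsq : ℝ) : Prop where
  markov : IsMarkovKernel noise
  integrable : ∀ᵐ x ∂P, Integrable (fun e : ℝ => e) (noise x)
  mean_zero : ∀ᵐ x ∂P, ∫ e, e ∂(noise x) = 0
  variance_eq : ∀ᵐ x ∂P, ∫⁻ e, ENNReal.ofReal (e ^ 2) ∂(noise x) = ENNReal.ofReal σsq

/-- The joint law of `(X, Y)`, where `Y = Xᵀθ + ε`. -/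
def sampleLaw {d : ℕ} (P : Measure (Vec d)) (noise : Kernel (Vec d) ℝ) (θ : Vec d) :
    Measure (Vec d × ℝ) :=
  (P ⊗ₘ noise).map fun z => (z.1, inner ℝ z.1 θ + z.2)

/-- The population risk `R(f) = E[(Y - f(X))²]`. -/
def risk {d : ℕ} (P : Measure (Vec d)) (noise : Kernel (Vec d) ℝ) (θ : Vec d)
    (f : Vec d → ℝ) : ℝ≥0∞ :=
  ∫⁻ z, ENNReal.ofReal ((z.2 - f z.1) ^ 2) ∂(sampleLaw P noise θ)

/-- A linear prediction rule `f̂(x) = ∑ i, lᵢ(x) Yᵢ`. The weights `lᵢ(x)` are measurable functions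
of `x`, of the training covariates, and of a random seed that is independent of the data;
they do not depend on the training responses. -/
structure LinearRule (d n : ℕ) where
  Seed : Type
  [seedSpace : MeasurableSpace Seed]
  seedLaw : Measure Seed
  [seedProb : IsProbabilityMeasure seedLaw]
  weight : Vec d → (Fin n → Vec d) → Seed → Fin n → ℝ
  measurable_weight : Measurable fun p : Vec d × (Fin n → Vec d) × Seed =>
    weight p.1 p.2.1 p.2.2

attribute [instance] LinearRule.seedSpace LinearRule.seedProb

/-- The predictor obtained from the training set `D = ((X₁, Y₁), …, (Xₙ, Yₙ))` and the seed `s`. -/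
def LinearRule.predict {d n : ℕ} (r : LinearRule d n) (D : Fin n → Vec d × ℝ) (s : r.Seed)
    (x : Vec d) : ℝ :=
  ∑ i, r.weight x (fun i => (D i).1) s i * (D i).2

/-- The averaged excess risk `E[R(f̂)] - R(f⋆)`, the expectation being over an i.i.d. training set
of size `n` and over the seed; `f⋆(x) = xᵀθ` is the Bayes predictor. -/
def excessRisk {d n : ℕ} (P : Measure (Vec d)) (noise : Kernel (Vec d) ℝ) (θ : Vec d)
    (r : LinearRule d n) : ℝ≥0∞ :=
  (∫⁻ s, ∫⁻ D, risk P noise θ (r.predict D s) ∂(Measure.pi fun _ : Fin n => sampleLaw P noise θ)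
      ∂r.seedLaw)
    - risk P noise θ fun x => inner ℝ x θ

/-- The optimal averaged excess risk: the infimum over all linear prediction rules of the averaged
excess risk, averaged over `θ` with law `ν`. -/
def optimalRisk {d : ℕ} (n : ℕ) (P : Measure (Vec d)) (noise : Kernel (Vec d) ℝ)
    (ν : Measure (Vec d)) : ℝ≥0∞ :=
  ⨅ r : LinearRule d n, ∫⁻ θ, excessRisk P noise θ r ∂ν

/-- `Σ_H = H^{1/2} Σ H^{1/2}` with `Σ = E[X Xᵀ]` and `H = E[θ θᵀ]`. -/
def sigmaH {d : ℕ} (P ν : Measure (Vec d)) : Matrix (Fin d) (Fin d) ℝ :=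
  CFC.sqrt (secondMoment ν) * secondMoment P * CFC.sqrt (secondMoment ν)

/-- The first degree of freedom `df₁(S; μ) = Tr(S (S + μ I)⁻¹)`. -/
def df1 {d : ℕ} (S : Matrix (Fin d) (Fin d) ℝ) (μ : ℝ) : ℝ :=
  (S * (S + μ • (1 : Matrix (Fin d) (Fin d) ℝ))⁻¹).trace

/-- The `j`-th largest eigenvalue of a symmetric matrix, for `1 ≤ j ≤ d`, with multiplicity. -/
def eig {d : ℕ} {S : Matrix (Fin d) (Fin d) ℝ} (hS : S.IsHermitian) (j : ℕ) : ℝ :=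
  if h : 1 ≤ j ∧ j ≤ d then
    hS.eigenvalues₀ ⟨j - 1, by rw [Fintype.card_fin]; omega⟩
  else 0

/-- The uniform distribution on the unit sphere, as a measure on the whole space. -/
def uniformSphere (d : ℕ) : Measure (Vec d) :=
  (((volume : Measure (Vec d)).toSphere Set.univ)⁻¹ • (volume : Measure (Vec d)).toSphere).map
    Subtype.val

/-- The latent covariate `z = Σ^{-1/2} x`, where `Σ = E[X Xᵀ]` is the matrix of the law `P`. -/
def latent {d : ℕ} (P : Measure (Vec d)) (x : Vec d) : Vec d :=
  Matrix.toEuclideanCLM (𝕜 := ℝ) (CFC.sqrt (secondMoment P))⁻¹ x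

/-- `Z / ‖Z‖` is uniformly distributed on the unit sphere, where `Z = Σ^{-1/2} X`. -/
def IsotropicLatent {d : ℕ} (P : Measure (Vec d)) : Prop :=
  P.map (fun x => ‖latent P x‖⁻¹ • latent P x) = uniformSphere d

end LinearPrediction

end

open LinearPrediction

/-!
Without noise, a linear rule predicts `xᵀθ` by `∑ i, lᵢ(x) Xᵢᵀθ`. Averaging the squared error over
`θ` gives `‖H^{1/2} (x - ∑ i, lᵢ(x) Xᵢ)‖²` (`lintegral_excessRisk`), so the optimal risk is the
mean of `Tr ((I - Π) Σ_H)`, where `Π` is the projection onto the span of the `H^{1/2} Xᵢ`. In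
orthonormal coordinates that diagonalize `Σ_H`, the vector `H^{1/2} Xᵢ` is the latent covariate
`Zᵢ` with its coordinates scaled by the `√λⱼ` (`exists_isometries`). The span depends only on the
directions `Zᵢ / ‖Zᵢ‖`, hence the optimal risk is at least `meanSpanRisk`, a function of `n` and
of the eigenvalues `λⱼ` of `Σ_H` alone (`meanSpanRisk_le_optimalRisk`). The direction of a
standard Gaussian vector is also uniform, because a rotation-invariant probability measure on the
sphere is unique (`eq_of_rotation_invariant`); so the `Zᵢ` may be taken Gaussian, with independent
coordinates.

*Lower bound.* Let `gⱼ ∈ ℝⁿ` be the `j`-th column of the Gaussian matrix. If `gⱼ = ∑ l, aₗ gₗ` is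
a combination of `m = k - 1` other columns with positive eigenvalues, then the squared distance of
the `j`-th coordinate vector to the span is at least `1 / (1 + λⱼ q)` with `q = ∑ l, aₗ² / λₗ`
(`le_distSq_scaled`). Take for `a` the representation given by the dual vectors of the rows
(`columnCoeff`). The length of a dual vector is the inverse of a distance from a Gaussian vector
to an independent subspace, whose inverse square has mean at most `1 / (m - n - 1)`, and the
columns are exchangeable: this gives `E aₗ² ≤ n / (m (m - n - 1))`. Convexity of
`q ↦ 1 / (1 + λⱼ q)` then bounds the risk below by `μ df₁(Σ_H; μ)`, where `n μ` is the
stated bound for this `k`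
(`le_meanSpanRisk`). When the rank exceeds `n`, the risk is positive (`meanSpanRisk_pos`), so a
small positive `μ` is admissible as well. The number `σ₀²` is the largest of these finitely many
values (`exists_noise_level`).

*Upper bound.* Approximate the `j`-th coordinate vector `eⱼ` by one gradient step
`aⱼ ∑ i, ⟨eⱼ, Wᵢ⟩ Wᵢ`, where `Wᵢ = H^{1/2} Xᵢ / ‖Zᵢ‖`. Its mean squared error involves
only the fourth moments
of the uniform distribution on the sphere, and a suitable step size `aⱼ` makes it at most
`μ / (λⱼ + μ)` with `μ = 3 Tr(Σ_H) / n` (`lintegral_norm_sq_stepResidual_le`). The error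
of the resulting
rule is the sum of these terms weighted by the `λⱼ` (`optimalRisk_le`).
-/

namespace LinearPrediction

open scoped Pointwise

/-! ### The uniform distribution on the sphere -/

theorem exists_linearIsometryEquiv_apply_eq {d : ℕ} {v w : Vec d} (h : ‖v‖ = ‖w‖) :
    ∃ O : Vec d ≃ₗᵢ[ℝ] Vec d, O v = w :=
  ⟨_, Submodule.reflection_sub h⟩

/-- A rotation-invariant probability measure on the unit sphere is unique. The characteristic
function of such a measure depends only on the norm of its argument; integrating it against the
second measure and exchanging the two integrals shows that the characteristic functions agree. -/
theorem eq_of_rotation_invariant {d : ℕ} {σ τ : Measure (Vec d)} [IsProbabilityMeasure σ]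
    [IsProbabilityMeasure τ] (hσ : ∀ O : Vec d ≃ₗᵢ[ℝ] Vec d, σ.map O = σ)
    (hτ : ∀ O : Vec d ≃ₗᵢ[ℝ] Vec d, τ.map O = τ)
    (hσ1 : ∀ᵐ u ∂σ, ‖u‖ = 1) (hτ1 : ∀ᵐ u ∂τ, ‖u‖ = 1) : σ = τ := by
  have inv : ∀ {ρ : Measure (Vec d)}, (∀ O : Vec d ≃ₗᵢ[ℝ] Vec d, ρ.map O = ρ) →
      ∀ {v w : Vec d}, ‖v‖ = ‖w‖ → charFun ρ v = charFun ρ w := by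
    intro ρ hρ v w h
    obtain ⟨O, rfl⟩ := exists_linearIsometryEquiv_apply_eq h
    conv_rhs => rw [← hρ O]
    rw [charFun_apply, charFun_apply, integral_map (by fun_prop) (by fun_prop)]
    simp [O.inner_map_map]
  apply Measure.ext_of_charFun
  ext t
  have key : ∀ {ρ ρ' : Measure (Vec d)} [IsProbabilityMeasure ρ] [IsProbabilityMeasure ρ'],
      (∀ O : Vec d ≃ₗᵢ[ℝ] Vec d, ρ.map O = ρ) → (∀ᵐ u ∂ρ', ‖u‖ = 1) →
      charFun ρ t = ∫ v, ∫ u, Complex.exp ((‖t‖ * inner ℝ u v : ℝ) * Complex.I) ∂ρ ∂ρ' := by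
    intro ρ ρ' _ _ h1 h2
    have : ∀ᵐ v ∂ρ', ∫ u, Complex.exp ((‖t‖ * inner ℝ u v : ℝ) * Complex.I) ∂ρ
        = charFun ρ t := by
      filter_upwards [h2] with v hv
      rw [inv h1 (v := t) (w := ‖t‖ • v) (by rw [norm_smul, hv]; simp), charFun_apply]
      simp [inner_smul_right]
    rw [integral_congr_ae this]
    simp
  rw [key hσ hτ1, key hτ hσ1, integral_integral_swap]
  · simp_rw [real_inner_comm]
  · apply Integrable.of_bound (C := 1)
    · apply Measurable.aestronglyMeasurable
      fun_prop
    · refine Filter.Eventually.of_forall fun p => ?_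
      simp only [Function.uncurry]
      rw [Complex.norm_exp_ofReal_mul_I]

theorem measurable_direction {d : ℕ} : Measurable fun x : Vec d => ‖x‖⁻¹ • x :=
  (measurable_norm.inv).smul measurable_id

theorem uniformSphere_norm {d : ℕ} : ∀ᵐ u ∂(uniformSphere d), ‖u‖ = 1 := by
  rw [uniformSphere, ae_map_iff (by fun_prop) (measurableSet_eq_fun (by fun_prop) (by fun_prop))]
  exact Filter.Eventually.of_forall fun x => by simp

theorem isProbabilityMeasure_uniformSphere {d : ℕ} (hd : 0 < d) :
    IsProbabilityMeasure (uniformSphere d) := by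
  have : Nontrivial (Vec d) := by
    have : Nonempty (Fin d) := ⟨⟨0, hd⟩⟩
    infer_instance
  constructor
  rw [uniformSphere, Measure.map_apply (by fun_prop) .univ, Set.preimage_univ, Measure.smul_apply,
    smul_eq_mul, ENNReal.inv_mul_cancel]
  · exact Measure.measure_univ_ne_zero.2 (Measure.toSphere_ne_zero _)
  · exact measure_ne_top _ _

theorem uniformSphere_map {d : ℕ} (O : Vec d ≃ₗᵢ[ℝ] Vec d) :
    (uniformSphere d).map O = uniformSphere d := by
  ext A hA
  have key : ∀ A : Set (Vec d), MeasurableSet A → uniformSphere d A =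
      ((volume : Measure (Vec d)).toSphere Set.univ)⁻¹ * (Module.finrank ℝ (Vec d) *
        volume (Set.Ioo (0 : ℝ) 1 • (A ∩ Metric.sphere 0 1))) := by
    intro A hA
    rw [uniformSphere, Measure.map_apply (by fun_prop) hA, Measure.smul_apply, smul_eq_mul,
      Measure.toSphere_apply' _ (measurable_subtype_coe hA), Subtype.image_preimage_coe,
      Set.inter_comm]
  have hO : Measurable O := O.continuous.measurable
  rw [Measure.map_apply hO hA, key _ (hO hA), key _ hA]
  congr 2
  conv_rhs => rw [← (O.measurePreserving).measure_preimage_emb O.toHomeomorph.measurableEmbedding]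
  congr 1
  ext x
  simp only [Set.mem_smul, Set.mem_preimage]
  constructor
  · rintro ⟨r, hr, y, ⟨hy, hy1⟩, rfl⟩
    exact ⟨r, hr, O y, ⟨hy, by simpa using hy1⟩, by simp⟩
  · rintro ⟨r, hr, y, ⟨hy, hy1⟩, h⟩
    refine ⟨r, hr, O.symm y, ⟨by simpa using hy, by simpa using hy1⟩, ?_⟩
    apply O.injective
    simp [h]

theorem stdGaussian_singleton_zero {d : ℕ} (hd : 0 < d) :
    ∀ᵐ x ∂(stdGaussian (Vec d)), x ≠ 0 := by
  have : ∀ᵐ x ∂(Measure.pi fun _ : Fin d => gaussianReal 0 1), x ⟨0, hd⟩ ≠ 0 := by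
    have := nullSingletonClass_gaussianReal (μ := 0) (v := 1) one_ne_zero
    exact Measure.ae_eval_ne (μ := fun _ : Fin d => gaussianReal 0 1) ⟨0, hd⟩ 0
  rw [← map_pi_eq_stdGaussian, ae_map_iff (p := fun x => x ≠ 0) (by fun_prop)
    (measurableSet_singleton 0).compl]
  filter_upwards [this] with x hx h
  apply hx
  have := congrArg (fun z : Vec d => z ⟨0, hd⟩) h
  simpa using this

/-- The direction of a standard Gaussian vector is uniform on the sphere. -/
theorem stdGaussian_map_direction {d : ℕ} (hd : 0 < d) :
    (stdGaussian (Vec d)).map (fun x => ‖x‖⁻¹ • x) = uniformSphere d := by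
  have := isProbabilityMeasure_uniformSphere hd
  have := Measure.isProbabilityMeasure_map (μ := stdGaussian (Vec d))
    (measurable_direction (d := d)).aemeasurable
  refine eq_of_rotation_invariant (fun O => ?_) uniformSphere_map ?_ uniformSphere_norm
  · have hO : Measurable O := O.continuous.measurable
    rw [Measure.map_map hO measurable_direction]
    conv_rhs => rw [← stdGaussian_map O, Measure.map_map measurable_direction hO]
    congr 1
    ext1 x
    simp
  · rw [ae_map_iff measurable_direction.aemeasurable
      (measurableSet_eq_fun (by fun_prop) (by fun_prop))]
    filter_upwards [stdGaussian_singleton_zero hd] with x hx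
    simp [norm_smul, hx]

theorem memLp_two_uniformSphere {d : ℕ} (hd : 0 < d) {f : Vec d → ℝ}
    (hf : Continuous f) : MemLp f 2 (uniformSphere d) := by
  have := isProbabilityMeasure_uniformSphere hd
  obtain ⟨C, hC⟩ := (isCompact_sphere (0 : Vec d) 1).exists_bound_of_continuousOn hf.continuousOn
  refine MemLp.of_bound hf.aestronglyMeasurable C ?_
  filter_upwards [uniformSphere_norm] with u hu
  exact hC u (by simpa using hu)

theorem integral_uniformSphere_comp {d : ℕ} {v w : Vec d} (h : ‖v‖ = ‖w‖) (f : ℝ → ℝ)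
    (hf : Continuous f) :
    ∫ u, f (inner ℝ v u) ∂(uniformSphere d) = ∫ u, f (inner ℝ w u) ∂(uniformSphere d) := by
  obtain ⟨O, rfl⟩ := exists_linearIsometryEquiv_apply_eq h
  conv_rhs => rw [← uniformSphere_map O]
  rw [integral_map O.continuous.aemeasurable (by fun_prop)]
  simp


/-- By rotation invariance all directions have the same second moment, and these sum to `1` over an
orthonormal basis. -/
theorem integral_inner_sq_uniformSphere {d : ℕ} (hd : 0 < d) {v : Vec d} (hv : ‖v‖ = 1) :
    ∫ u, inner ℝ v u ^ 2 ∂(uniformSphere d) = 1 / d := by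
  have := isProbabilityMeasure_uniformSphere hd
  have hd' : (d : ℝ) ≠ 0 := by positivity
  have h : ∑ _j : Fin d, ∫ u, inner ℝ v u ^ 2 ∂(uniformSphere d) = 1 := by
    have h1 : ∀ j : Fin d, ∫ u, inner ℝ v u ^ 2 ∂(uniformSphere d) =
        ∫ u, inner ℝ (EuclideanSpace.basisFun (Fin d) ℝ j) u ^ 2 ∂(uniformSphere d) := fun j =>
      integral_uniformSphere_comp (by simp [hv]) (fun x => x ^ 2) (by fun_prop)
    rw [Finset.sum_congr rfl fun j _ => h1 j, ← integral_finsetSum]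
    · rw [integral_congr_ae (g := fun _ => 1)]
      · simp
      · filter_upwards [uniformSphere_norm] with u hu
        rw [(EuclideanSpace.basisFun (Fin d) ℝ).sum_sq_inner_right, hu, one_pow]
    · exact fun j _ => (memLp_two_uniformSphere hd (by fun_prop)).integrable one_le_two
  rw [Finset.sum_const, Finset.card_univ, Fintype.card_fin, nsmul_eq_mul] at h
  field_simp
  linarith

theorem integrable_uniformSphere {d : ℕ} (hd : 0 < d) {f : Vec d → ℝ}
    (hf : Continuous f) : Integrable f (uniformSphere d) :=
  have := isProbabilityMeasure_uniformSphere hd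
  (memLp_two_uniformSphere hd hf).integrable one_le_two

theorem norm_add_sub_orthonormal {d : ℕ} {v w : Vec d} (hv : ‖v‖ = 1) (hw : ‖w‖ = 1)
    (h : inner ℝ v w = 0) : ‖v + w‖ = ‖v - w‖ ∧ ‖v + w‖ = ‖√2 • v‖ := by
  have e1 : ‖v + w‖ ^ 2 = 2 := by rw [norm_add_sq_real, hv, hw, h]; norm_num
  have e2 : ‖v - w‖ ^ 2 = 2 := by rw [norm_sub_sq_real, hv, hw, h]; norm_num
  have e3 : ‖√2 • v‖ ^ 2 = 2 := by rw [norm_smul, hv]; simp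
  constructor
  · rw [← sq_eq_sq₀ (norm_nonneg _) (norm_nonneg _), e1, e2]
  · rw [← sq_eq_sq₀ (norm_nonneg _) (norm_nonneg _), e1, e3]

theorem integral_inner_mul_inner_uniformSphere {d : ℕ} (hd : 0 < d) {v w : Vec d} (hv : ‖v‖ = 1)
    (hw : ‖w‖ = 1) (h : inner ℝ v w = 0) :
    ∫ u, inner ℝ v u * inner ℝ w u ∂(uniformSphere d) = 0 := by
  have h1 := integral_uniformSphere_comp (norm_add_sub_orthonormal hv hw h).1 (fun x => x ^ 2)
    (by fun_prop)
  have h2 : ∀ u : Vec d, inner ℝ v u * inner ℝ w u =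
      4⁻¹ * (inner ℝ (v + w) u ^ 2 - inner ℝ (v - w) u ^ 2) := by
    intro u
    rw [inner_add_left, inner_sub_left]
    ring
  simp_rw [h2]
  rw [integral_const_mul, integral_sub (integrable_uniformSphere hd (by fun_prop))
    (integrable_uniformSphere hd (by fun_prop)), h1]
  simp

/-- Rotating an orthonormal pair `v, w` by 45 degrees relates the mixed fourth moment to the
pure one. -/
theorem integral_inner_pow_four_eq {d : ℕ} (hd : 0 < d) {v w : Vec d} (hv : ‖v‖ = 1)
    (hw : ‖w‖ = 1) (h : inner ℝ v w = 0) :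
    ∫ u, inner ℝ v u ^ 4 ∂(uniformSphere d) =
      3 * ∫ u, (inner ℝ v u * inner ℝ w u) ^ 2 ∂(uniformSphere d) := by
  have h1 := integral_uniformSphere_comp (norm_add_sub_orthonormal hv hw h).1 (fun x => x ^ 4)
    (by fun_prop)
  have h2 := integral_uniformSphere_comp (norm_add_sub_orthonormal hv hw h).2 (fun x => x ^ 4)
    (by fun_prop)
  have h3 := integral_uniformSphere_comp (hv.trans hw.symm) (fun x => x ^ 4) (by fun_prop)
  have h4 : ∀ u : Vec d, 12 * (inner ℝ v u * inner ℝ w u) ^ 2 =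
      (inner ℝ (v + w) u ^ 4 + inner ℝ (v - w) u ^ 4) -
        (2 * inner ℝ v u ^ 4 + 2 * inner ℝ w u ^ 4) := by
    intro u
    rw [inner_add_left, inner_sub_left]
    ring
  have h5 : ∫ u, inner ℝ (√2 • v) u ^ 4 ∂(uniformSphere d) =
      4 * ∫ u, inner ℝ v u ^ 4 ∂(uniformSphere d) := by
    rw [← integral_const_mul]
    congr 1
    ext u
    rw [real_inner_smul_left, mul_pow, show (√2) ^ 4 = ((√2) ^ 2) ^ 2 by ring,
      Real.sq_sqrt (by norm_num)]
    norm_num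
  have h6 : ∫ u, 12 * (inner ℝ v u * inner ℝ w u) ^ 2 ∂(uniformSphere d) =
      (∫ u, inner ℝ (v + w) u ^ 4 ∂(uniformSphere d) +
        ∫ u, inner ℝ (v - w) u ^ 4 ∂(uniformSphere d)) -
      (2 * ∫ u, inner ℝ v u ^ 4 ∂(uniformSphere d) +
        2 * ∫ u, inner ℝ w u ^ 4 ∂(uniformSphere d)) := by
    simp_rw [h4]
    rw [integral_sub, integral_add, integral_add, integral_const_mul, integral_const_mul]
    all_goals exact integrable_uniformSphere hd (by fun_prop)
  rw [integral_const_mul] at h6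
  linarith

/-- The mixed fourth moment, from `integral_inner_pow_four_eq` and the expansion of `‖u‖ ^ 4 = 1` in
an orthonormal basis. -/
theorem integral_inner_mul_inner_sq_uniformSphere {d : ℕ} (hd : 0 < d) {v w : Vec d}
    (hv : ‖v‖ = 1) (hw : ‖w‖ = 1) (h : inner ℝ v w = 0) :
    ∫ u, (inner ℝ v u * inner ℝ w u) ^ 2 ∂(uniformSphere d) = 1 / (d * (d + 2)) := by
  have := isProbabilityMeasure_uniformSphere hd
  set κ := ∫ u, inner ℝ v u ^ 4 ∂(uniformSphere d) with hκ
  have hd' : (0 : ℝ) < d := by positivity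
  let b := EuclideanSpace.basisFun (Fin d) ℝ
  have key : ∀ j k : Fin d, ∫ u, (inner ℝ (b j) u * inner ℝ (b k) u) ^ 2 ∂(uniformSphere d) =
      κ / 3 + if j = k then 2 * κ / 3 else 0 := by
    intro j k
    have hj : ∫ u, inner ℝ (b j) u ^ 4 ∂(uniformSphere d) = κ :=
      integral_uniformSphere_comp (by simp [hv]) (fun x => x ^ 4) (by fun_prop)
    split_ifs with hjk
    · subst hjk
      rw [show κ / 3 + 2 * κ / 3 = κ by ring, ← hj]
      congr 1
      ext u
      ring
    · rw [integral_inner_pow_four_eq hd (by simp) (by simp) (b.orthonormal.2 hjk)] at hj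
      linarith
  have tot : ∑ j, ∑ k, ∫ u, (inner ℝ (b j) u * inner ℝ (b k) u) ^ 2 ∂(uniformSphere d) = 1 := by
    have h1 : ∀ j k, Integrable (fun u => (inner ℝ (b j) u * inner ℝ (b k) u) ^ 2)
        (uniformSphere d) := fun j k => integrable_uniformSphere hd (by
          generalize b j = v; generalize b k = w; fun_prop)
    rw [Finset.sum_congr rfl fun j _ => (integral_finsetSum _ fun k _ => h1 j k).symm,
      ← integral_finsetSum _ fun j _ => integrable_finsetSum _ fun k _ => h1 j k]
    rw [integral_congr_ae (g := fun _ => 1)]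
    · simp
    · filter_upwards [uniformSphere_norm] with u hu
      simp_rw [mul_pow, ← Finset.mul_sum, ← Finset.sum_mul, b.sum_sq_inner_right, hu]
      norm_num
  simp_rw [key] at tot
  simp [Finset.sum_add_distrib] at tot
  have := integral_inner_pow_four_eq hd hv hw h
  rw [eq_div_iff (by positivity)]
  linear_combination tot - (d * (d + 2) / 3 : ℝ) * this

/-! ### Inverse moments of Gaussian vectors -/

theorem lintegral_exp_neg_mul_sq_gaussianReal {s : ℝ} (hs : 0 ≤ s) :
    ∫⁻ x, ENNReal.ofReal (Real.exp (-s * x ^ 2)) ∂(gaussianReal 0 1) =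
      ENNReal.ofReal ((1 + 2 * s) ^ (-(1 / 2) : ℝ)) := by
  rw [← ofReal_integral_eq_lintegral_ofReal]
  · congr 1
    rw [integral_gaussianReal_eq_integral_smul one_ne_zero]
    have h : ∀ x : ℝ, gaussianPDFReal 0 1 x • Real.exp (-s * x ^ 2) =
        (√(2 * Real.pi))⁻¹ * Real.exp (-((1 + 2 * s) / 2) * x ^ 2) := by
      intro x
      rw [gaussianPDFReal, smul_eq_mul, mul_assoc, ← Real.exp_add]
      simp only [NNReal.coe_one, mul_one, sub_zero]
      congr 2
      ring
    simp_rw [h]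
    rw [integral_const_mul, integral_gaussian, ← Real.sqrt_inv, ← Real.sqrt_mul (by positivity),
      Real.rpow_neg (by positivity), ← Real.sqrt_eq_rpow, ← Real.sqrt_inv]
    congr 1
    field_simp
  · apply Integrable.of_bound (C := 1) (by fun_prop)
    refine Filter.Eventually.of_forall fun x => ?_
    rw [Real.norm_eq_abs, Real.abs_exp, Real.exp_le_one_iff]
    nlinarith [mul_nonneg hs (sq_nonneg x)]
  · exact Filter.Eventually.of_forall fun x => (Real.exp_pos _).le

theorem lintegral_pi_exp_neg_mul_sq {p : ℕ} {s : ℝ} (hs : 0 ≤ s) :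
    ∫⁻ x : Fin p → ℝ, ENNReal.ofReal (Real.exp (-s * ∑ i, x i ^ 2))
      ∂(Measure.pi fun _ : Fin p => gaussianReal 0 1) =
      ENNReal.ofReal ((1 + 2 * s) ^ (-(p / 2) : ℝ)) := by
  have h : ∀ x : Fin p → ℝ, ENNReal.ofReal (Real.exp (-s * ∑ i, x i ^ 2)) =
      ∏ i, ENNReal.ofReal (Real.exp (-s * x i ^ 2)) := by
    intro x
    rw [← ENNReal.ofReal_prod_of_nonneg fun i _ => (Real.exp_pos _).le, Finset.mul_sum,
      Real.exp_sum]
  simp_rw [h]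
  rw [lintegral_prod_eq_prod_lintegral_of_indepFun Finset.univ
    (fun (i : Fin p) (x : Fin p → ℝ) => ENNReal.ofReal (Real.exp (-s * x i ^ 2)))]
  · have h1 : ∀ i : Fin p, ∫⁻ x : Fin p → ℝ, ENNReal.ofReal (Real.exp (-s * x i ^ 2))
      ∂(Measure.pi fun _ : Fin p => gaussianReal 0 1) =
      ENNReal.ofReal ((1 + 2 * s) ^ (-(1 / 2) : ℝ)) := by
      intro i
      rw [← lintegral_exp_neg_mul_sq_gaussianReal hs]
      exact (measurePreserving_eval (fun _ : Fin p => gaussianReal 0 1) i).lintegral_comp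
        (f := fun x => ENNReal.ofReal (Real.exp (-s * x ^ 2))) (by fun_prop)
    rw [Finset.prod_congr rfl fun i _ => h1 i, Finset.prod_const, Finset.card_univ,
      Fintype.card_fin, ← ENNReal.ofReal_pow (by positivity), ← Real.rpow_natCast,
      ← Real.rpow_mul (by positivity)]
    congr 2
    ring
  · exact iIndepFun_pi (X := fun _ x => ENNReal.ofReal (Real.exp (-s * x ^ 2)))
      fun i => by fun_prop
  · intro i
    fun_prop

theorem lintegral_exp_neg_mul {S : ℝ} (hS : 0 ≤ S) :
    ∫⁻ s in Set.Ioi (0 : ℝ), ENNReal.ofReal (Real.exp (-s * S)) = (ENNReal.ofReal S)⁻¹ := by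
  rcases hS.eq_or_lt with rfl | hS
  · simp
  · rw [← ofReal_integral_eq_lintegral_ofReal, ← ENNReal.ofReal_inv_of_pos hS]
    · congr 1
      have := integral_exp_mul_Ioi (a := -S) (by linarith) 0
      simp only [mul_zero, Real.exp_zero] at this
      rw [show (fun s : ℝ => Real.exp (-s * S)) = fun s => Real.exp (-S * s) by
        ext s; ring_nf, this]
      field_simp
    · rw [show (fun s : ℝ => Real.exp (-s * S)) = fun s => Real.exp (-S * s) by
        ext s; ring_nf]
      exact integrableOn_exp_mul_Ioi (by linarith) 0
    · exact Filter.Eventually.of_forall fun x => (Real.exp_pos _).le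

theorem lintegral_one_add_two_mul_rpow {a : ℝ} (ha : 1 < a) :
    ∫⁻ s in Set.Ioi (0 : ℝ), ENNReal.ofReal ((1 + 2 * s) ^ (-a)) =
      ENNReal.ofReal (1 / (2 * a - 2)) := by
  have hderiv : ∀ x ∈ Set.Ioi (0 : ℝ), HasDerivAt (fun s : ℝ =>
      (1 + 2 * s) ^ (1 - a) * (2 * (1 - a))⁻¹) ((1 + 2 * x) ^ (-a)) x := by
    intro x hx
    have hx : (0 : ℝ) < x := hx
    have h1 : HasDerivAt (fun s : ℝ => 1 + 2 * s) 2 x := by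
      simpa using ((hasDerivAt_id x).const_mul 2).const_add 1
    have := (h1.rpow_const (p := 1 - a) (Or.inl (by positivity))).mul_const (2 * (1 - a))⁻¹
    have h2 : 1 - a ≠ 0 := by linarith
    rw [show 2 * (1 - a) * (1 + 2 * x) ^ (1 - a - 1) * (2 * (1 - a))⁻¹ = (1 + 2 * x) ^ (-a) by
      rw [show (1 - a - 1 : ℝ) = -a by ring]
      field_simp] at this
    exact this
  have hcont : ContinuousWithinAt (fun s : ℝ => (1 + 2 * s) ^ (1 - a) * (2 * (1 - a))⁻¹)
      (Set.Ici 0) 0 := by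
    apply ContinuousAt.continuousWithinAt
    apply ContinuousAt.mul_const
    apply ContinuousAt.rpow_const (by fun_prop)
    norm_num
  have hlim : Filter.Tendsto (fun s : ℝ => (1 + 2 * s) ^ (1 - a) * (2 * (1 - a))⁻¹)
      Filter.atTop (nhds 0) := by
    have h2 : Filter.Tendsto (fun s : ℝ => 1 + 2 * s) Filter.atTop Filter.atTop :=
      Filter.tendsto_atTop_add_const_left _ _ (Filter.tendsto_id.const_mul_atTop (by norm_num))
    have := ((tendsto_rpow_neg_atTop (y := a - 1) (by linarith)).comp h2).mul_const
      (2 * (1 - a))⁻¹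
    simpa [Function.comp_def] using this
  have hpos : ∀ x ∈ Set.Ioi (0 : ℝ), 0 ≤ (1 + 2 * x) ^ (-a) := by
    intro x hx
    have hx : (0 : ℝ) < x := hx
    positivity
  have hint := integrableOn_Ioi_deriv_of_nonneg hcont hderiv hpos hlim
  rw [← ofReal_integral_eq_lintegral_ofReal hint (ae_restrict_of_forall_mem measurableSet_Ioi hpos),
    integral_Ioi_of_hasDerivAt_of_nonneg hcont hderiv hpos hlim]
  congr 1
  rw [mul_zero, add_zero, Real.one_rpow, zero_sub, one_mul, ← inv_neg, one_div]
  congr 1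
  ring

/-- The inverse moment of a chi-squared variable with `p` degrees of freedom is `1 / (p - 2)`: write
`1 / ‖x‖ ^ 2` as the integral of `exp (-s * ‖x‖ ^ 2)` over `s > 0`, and exchange the integrals. -/
theorem lintegral_inv_norm_sq_stdGaussian {F : Type*} [NormedAddCommGroup F]
    [InnerProductSpace ℝ F] [FiniteDimensional ℝ F] [MeasurableSpace F] [BorelSpace F]
    (hp : 2 < Module.finrank ℝ F) :
    ∫⁻ x, (ENNReal.ofReal (‖x‖ ^ 2))⁻¹ ∂(stdGaussian F) =
      ENNReal.ofReal (1 / (Module.finrank ℝ F - 2)) := by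
  set p := Module.finrank ℝ F with hp'
  let b := stdOrthonormalBasis ℝ F
  rw [stdGaussian_eq_map_pi_orthonormalBasis b, lintegral_map (by fun_prop) (by fun_prop)]
  have h : ∀ x : Fin p → ℝ, (ENNReal.ofReal (‖∑ i, x i • b i‖ ^ 2))⁻¹ =
      ∫⁻ s in Set.Ioi (0 : ℝ), ENNReal.ofReal (Real.exp (-s * ∑ i, x i ^ 2)) := by
    intro x
    have h1 : ‖∑ i, x i • b i‖ ^ 2 = ∑ i, x i ^ 2 := by
      rw [← b.sum_sq_inner_right]
      simp [inner_sum, inner_smul_right, b.inner_eq_ite]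
      rfl
    rw [h1, lintegral_exp_neg_mul (by positivity)]
  rw [lintegral_congr h, lintegral_lintegral_swap (by fun_prop)]
  have hp2 : (2 : ℝ) < p := by exact_mod_cast hp
  rw [setLIntegral_congr_fun measurableSet_Ioi
    (fun s (hs : 0 < s) => lintegral_pi_exp_neg_mul_sq (p := p) hs.le),
    lintegral_one_add_two_mul_rpow (by linarith)]
  congr 2
  ring

theorem stdGaussian_map_orthogonalProjection {E : Type*} [NormedAddCommGroup E]
    [InnerProductSpace ℝ E] [FiniteDimensional ℝ E] [MeasurableSpace E] [BorelSpace E]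
    (K : Submodule ℝ E) :
    (stdGaussian E).map K.orthogonalProjectionOnto = stdGaussian K := by
  apply Measure.ext_of_charFun
  ext t
  rw [charFun_stdGaussian, charFun_apply, integral_map (by fun_prop) (by fun_prop)]
  have := charFun_stdGaussian (E := E) (t : E)
  rw [charFun_apply] at this
  simp only [Submodule.coe_norm] at *
  rw [← this]
  congr 1
  ext x
  rw [Submodule.inner_orthogonalProjectionOnto_eq_of_mem_right]

/-- The inverse squared distance of a standard Gaussian vector to a subspace has mean at most
`1 / (c - 2)`, where `c` is a lower bound on the codimension. -/
theorem lintegral_inv_norm_sq_starProjection_le {m p : ℕ} (hp : p + 2 < m)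
    (V : Submodule ℝ (Vec m)) (hV : Module.finrank ℝ V ≤ p) :
    ∫⁻ x, (ENNReal.ofReal (‖Vᗮ.starProjection x‖ ^ 2))⁻¹ ∂(stdGaussian (Vec m)) ≤
      ENNReal.ofReal (1 / (m - p - 2)) := by
  have h := V.finrank_add_finrank_orthogonal
  rw [finrank_euclideanSpace_fin] at h
  have h1 : ∀ x, ‖Vᗮ.starProjection x‖ = ‖Vᗮ.orthogonalProjectionOnto x‖ := fun x => rfl
  simp_rw [h1]
  have h2 : ∫⁻ x, (ENNReal.ofReal (‖Vᗮ.orthogonalProjectionOnto x‖ ^ 2))⁻¹ ∂(stdGaussian (Vec m)) =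
      ∫⁻ x, (ENNReal.ofReal (‖x‖ ^ 2))⁻¹ ∂(stdGaussian Vᗮ) := by
    rw [← stdGaussian_map_orthogonalProjection, lintegral_map (by fun_prop) (by fun_prop)]
  rw [h2, lintegral_inv_norm_sq_stdGaussian (by omega)]
  apply ENNReal.ofReal_le_ofReal
  have e1 : (m : ℝ) ≤ p + Module.finrank ℝ Vᗮ := by exact_mod_cast (by omega)
  have e2 : (p : ℝ) + 2 < m := by exact_mod_cast hp
  apply one_div_le_one_div_of_le <;> linarith

/-- The inverse squared distance to the subspace is integrable, hence almost surely finite. -/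
theorem ae_notMem_of_finrank_le {m p : ℕ} (hp : p + 2 < m)
    (V : Submodule ℝ (Vec m)) (hV : Module.finrank ℝ V ≤ p) :
    ∀ᵐ x ∂(stdGaussian (Vec m)), x ∉ V := by
  have h := (lintegral_inv_norm_sq_starProjection_le hp V hV).trans_lt ENNReal.ofReal_lt_top
  filter_upwards [ae_lt_top (by fun_prop) h.ne] with x hx hxV
  have : Vᗮ.starProjection x = 0 := by
    rw [Submodule.starProjection_orthogonal_apply_eq_zero hxV]
  rw [this] at hx
  simp at hx

/-! ### Dual vectors of Gaussian families -/

/-- The dual family of a linearly independent family `R`: it lies in the span of `R` and is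
biorthogonal to `R`. It vanishes when `R` is linearly dependent, because the inverse of a singular
matrix is zero by convention. -/
noncomputable def dualVec {n m : ℕ} (R : Fin n → Vec m) (i : Fin n) : Vec m :=
  ∑ k, (Matrix.gram ℝ R)⁻¹ i k • R k

theorem measurable_gram_inv {n m : ℕ} (i k : Fin n) :
    Measurable fun R : Fin n → Vec m => (Matrix.gram ℝ R)⁻¹ i k := by
  have hg : Continuous fun R : Fin n → Vec m => Matrix.gram ℝ R := by
    refine continuous_matrix fun i j => ?_
    simp only [Matrix.gram_apply]
    fun_prop
  simp_rw [Matrix.inv_def, Ring.inverse_eq_inv', Matrix.smul_apply, smul_eq_mul]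
  exact hg.matrix_det.measurable.inv.mul (hg.matrix_adjugate.matrix_elem i k).measurable

theorem measurable_dualVec {n m : ℕ} (i : Fin n) :
    Measurable fun R : Fin n → Vec m => dualVec R i :=
  Finset.measurable_sum _ fun k _ => (measurable_gram_inv i k).smul (measurable_pi_apply k)

theorem inner_dualVec {n m : ℕ} {R : Fin n → Vec m} (h : (Matrix.gram ℝ R).det ≠ 0)
    (i k : Fin n) : inner ℝ (dualVec R i) (R k) = if i = k then 1 else 0 := by
  have := congrFun (congrFun (Matrix.nonsing_inv_mul _ (isUnit_iff_ne_zero.2 h)) i) k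
  rw [Matrix.mul_apply, Matrix.one_apply] at this
  rw [← this, dualVec, sum_inner]
  simp [Matrix.gram_apply, real_inner_smul_left]

theorem norm_sq_dualVec {n m : ℕ} {R : Fin n → Vec m} (h : (Matrix.gram ℝ R).det ≠ 0)
    (i : Fin n) : ‖dualVec R i‖ ^ 2 = (Matrix.gram ℝ R)⁻¹ i i := by
  rw [← real_inner_self_eq_norm_sq]
  nth_rw 2 [dualVec]
  simp [inner_sum, real_inner_smul_right, inner_dualVec h]

/-- The dual vector of `R i` has length the inverse of the distance of `R i` to the span of the
other vectors. When the family is dependent, its dual vectors are zero by convention, and the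
inequality is trivial. -/
theorem norm_sq_dualVec_le {n m : ℕ} (R : Fin n → Vec m) (i : Fin n) :
    ENNReal.ofReal (‖dualVec R i‖ ^ 2) ≤
      (ENNReal.ofReal (‖(Submodule.span ℝ (R '' {i}ᶜ))ᗮ.starProjection (R i)‖ ^ 2))⁻¹ := by
  by_cases h : (Matrix.gram ℝ R).det = 0
  · have : dualVec R i = 0 := by
      simp [dualVec, Matrix.inv_def, h]
    simp [this]
  set V := Submodule.span ℝ (R '' {i}ᶜ) with hV
  have hb : dualVec R i ∈ Vᗮ := by
    rw [Submodule.mem_orthogonal']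
    intro u hu
    induction hu using Submodule.span_induction with
    | mem x hx =>
      obtain ⟨k, hk, rfl⟩ := hx
      rw [inner_dualVec h, if_neg]
      rintro rfl
      exact hk rfl
    | zero => simp
    | add x y _ _ hx hy => rw [inner_add_right, hx, hy, add_zero]
    | smul a x _ hx => rw [inner_smul_right, hx, mul_zero]
  have hdecomp : dualVec R i - (Matrix.gram ℝ R)⁻¹ i i • R i ∈ V := by
    rw [dualVec, ← Finset.add_sum_erase _ _ (Finset.mem_univ i), add_sub_cancel_left]
    refine Submodule.sum_mem _ fun k hk => Submodule.smul_mem _ _ (Submodule.subset_span ?_)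
    exact ⟨k, by simpa using (Finset.ne_of_mem_erase hk), rfl⟩
  -- Both the dual vector and its `R i`-component project to `dualVec R i`; comparing norms shows
  -- that the product of the two lengths is one.
  have hQ : Vᗮ.starProjection (dualVec R i - (Matrix.gram ℝ R)⁻¹ i i • R i) = 0 :=
    Submodule.starProjection_orthogonal_apply_eq_zero hdecomp
  rw [map_sub, map_smul, Submodule.starProjection_eq_self_iff.2 hb, ← norm_sq_dualVec h,
    sub_eq_zero] at hQ
  have hne : dualVec R i ≠ 0 := by
    intro h0
    have := inner_dualVec h i i
    simp [h0] at this
  have hnorm := congrArg norm hQ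
  rw [norm_smul, norm_pow, norm_norm] at hnorm
  have hpos : 0 < ‖dualVec R i‖ := norm_pos_iff.2 hne
  have hone : ‖dualVec R i‖ * ‖Vᗮ.starProjection (R i)‖ = 1 := by
    apply mul_left_cancel₀ hpos.ne'
    linarith
  have hpos' : 0 < ‖Vᗮ.starProjection (R i)‖ := by
    by_contra hcon
    rw [le_antisymm (not_lt.1 hcon) (norm_nonneg _)] at hone
    simp at hone
  rw [← ENNReal.ofReal_inv_of_pos (by positivity), ← inv_pow]
  rw [eq_inv_of_mul_eq_one_left hone]

/-- `n` independent standard Gaussian vectors in dimension `m`. -/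
noncomputable abbrev gaussianRows (n m : ℕ) : Measure (Fin n → Vec m) :=
  Measure.pi fun _ => stdGaussian (Vec m)

theorem lintegral_norm_sq_dualVec_le {n m : ℕ} (hm : n + 2 ≤ m) (i : Fin n) :
    ∫⁻ R, ENNReal.ofReal (‖dualVec R i‖ ^ 2) ∂(gaussianRows n m) ≤
      ENNReal.ofReal (1 / (m - n - 1)) := by
  obtain ⟨n, rfl⟩ : ∃ k, n = k + 1 := ⟨n - 1, by have := i.2; omega⟩
  have hmp := (measurePreserving_piFinSuccAbove
    (fun _ : Fin (n + 1) => stdGaussian (Vec m)) i).symm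
  rw [← hmp.lintegral_comp_emb (MeasurableEquiv.measurableEmbedding _),
    lintegral_prod_symm']
  · -- With the other rows fixed, only the distance of a single Gaussian row to their span matters.
    have : ∀ R' : Fin n → Vec m, ∫⁻ r, ENNReal.ofReal (‖dualVec ((MeasurableEquiv.piFinSuccAbove
        (fun _ => Vec m) i).symm (r, R')) i‖ ^ 2) ∂(stdGaussian (Vec m)) ≤
        ENNReal.ofReal (1 / (m - (n + 1 : ℕ) - 1)) := by
      intro R'
      have hV : Module.finrank ℝ (Submodule.span ℝ (Set.range R')) ≤ n := 
        (finrank_range_le_card (R := ℝ) R').trans (by simp)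
      have hcast : (m : ℝ) - (n + 1 : ℕ) - 1 = m - n - 2 := by push_cast; ring
      rw [hcast]
      refine (lintegral_mono fun r => ?_).trans
        (lintegral_inv_norm_sq_starProjection_le (p := n) (by omega) _ hV)
      · refine (norm_sq_dualVec_le _ i).trans (le_of_eq ?_)
        have h1 : (MeasurableEquiv.piFinSuccAbove (fun _ => Vec m) i).symm (r, R') =
          i.insertNth r R' := rfl
        rw [h1]
        have h2 : (i.insertNth (α := fun _ => Vec m) r R') '' {i}ᶜ = Set.range R' := by
          rw [← Fin.range_succAbove, ← Set.range_comp]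
          congr 1
          ext j : 1
          simp
        rw [h2]
        simp
    exact (lintegral_mono this).trans (by simp)
  · exact ENNReal.measurable_ofReal.comp (((measurable_dualVec i).comp
      (MeasurableEquiv.measurable _)).norm.pow_const 2)

theorem ae_linearIndependent {n m : ℕ} (hm : n + 2 ≤ m) :
    ∀ᵐ R ∂(gaussianRows n m), LinearIndependent ℝ R := by
  induction n with
  | zero => exact Filter.Eventually.of_forall fun R => linearIndependent_empty_type
  | succ n ih =>
    have hmeas : MeasurableSet {R : Fin (n + 1) → Vec m | LinearIndependent ℝ R} := by
      have hg : Continuous fun R : Fin (n + 1) → Vec m => Matrix.gram ℝ R := by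
        refine continuous_matrix fun i j => ?_
        simp only [Matrix.gram_apply]
        fun_prop
      simp_rw [← Matrix.det_gram_ne_zero_iff_linearIndependent (𝕜 := ℝ)]
      exact (hg.matrix_det.measurable (measurableSet_singleton 0)).compl
    have hmp := (measurePreserving_piFinSuccAbove
      (fun _ : Fin (n + 1) => stdGaussian (Vec m)) 0).symm
    rw [gaussianRows, ← hmp.map_eq, ae_map_iff (MeasurableEquiv.measurable _).aemeasurable hmeas]
    have := (Measure.ae_prod_iff_ae_ae (μ := gaussianRows n m) (ν := stdGaussian (Vec m))
      (p := fun z => LinearIndependent ℝ (Fin.cons z.2 z.1 : Fin (n + 1) → Vec m)) ?_).2 ?_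
    · filter_upwards [Measure.measurePreserving_swap.quasiMeasurePreserving.ae this] with z hz
      have h1 : (MeasurableEquiv.piFinSuccAbove (fun _ => Vec m) 0).symm z = Fin.cons z.1 z.2 :=
        Fin.insertNth_zero' z.1 z.2
      rw [h1]
      exact hz
    · have : Measurable fun z : (Fin n → Vec m) × Vec m =>
          (Fin.cons z.2 z.1 : Fin (n + 1) → Vec m) := by
        refine measurable_pi_iff.2 fun j => ?_
        refine Fin.cases ?_ (fun j => ?_) j
        · simpa using measurable_snd
        · simp only [Fin.cons_succ]
          fun_prop
      exact this hmeas
    · filter_upwards [ih (by omega)] with R' hR'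
      have hV : Module.finrank ℝ (Submodule.span ℝ (Set.range R')) ≤ n := 
        (finrank_range_le_card (R := ℝ) R').trans (by simp)
      filter_upwards [ae_notMem_of_finrank_le (p := n) (by omega) _ hV] with r hr
      exact linearIndependent_finCons.2 ⟨hR', hr⟩

theorem gaussianRows_map {n m : ℕ} (O : Vec m ≃ₗᵢ[ℝ] Vec m) :
    MeasurePreserving (fun (R : Fin n → Vec m) i => O (R i)) (gaussianRows n m)
      (gaussianRows n m) :=
  measurePreserving_pi _ _ fun _ => ⟨O.continuous.measurable, stdGaussian_map O⟩

theorem dualVec_map {n m : ℕ} (O : Vec m ≃ₗᵢ[ℝ] Vec m) (R : Fin n → Vec m) (i : Fin n) :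
    dualVec (fun i => O (R i)) i = O (dualVec R i) := by
  have : Matrix.gram ℝ (fun i => O (R i)) = Matrix.gram ℝ R := by
    ext i j
    simp [Matrix.gram_apply]
  simp [dualVec, this]

/-- By exchangeability of the columns, the coordinates of the dual vectors have the same second
moments, so that each of them is the average of the squared norm. -/
theorem lintegral_sum_dualVec_sq_le {n m : ℕ} (hm : n + 2 ≤ m) (l : Fin m) :
    ∫⁻ R, ENNReal.ofReal (∑ i, (dualVec R i l) ^ 2) ∂(gaussianRows n m) ≤
      ENNReal.ofReal (n / (m * (m - n - 1))) := by
  have hm' : (n : ℝ) + 2 ≤ m := by exact_mod_cast hm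
  have hmeas : ∀ l : Fin m, Measurable fun R : Fin n → Vec m =>
      ENNReal.ofReal (∑ i, (dualVec R i l) ^ 2) := by
    intro l
    have : ∀ i, Measurable fun R : Fin n → Vec m => dualVec R i l := fun i =>
      (EuclideanSpace.proj (𝕜 := ℝ) l).continuous.measurable.comp (measurable_dualVec i)
    exact ENNReal.measurable_ofReal.comp
      (Finset.measurable_sum _ fun i _ => (this i).pow_const 2)
  have hsymm : ∀ l' : Fin m, ∫⁻ R, ENNReal.ofReal (∑ i, (dualVec R i l') ^ 2) ∂(gaussianRows n m) =
      ∫⁻ R, ENNReal.ofReal (∑ i, (dualVec R i l) ^ 2) ∂(gaussianRows n m) := by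
    intro l'
    let O : Vec m ≃ₗᵢ[ℝ] Vec m := LinearIsometryEquiv.piLpCongrLeft 2 ℝ ℝ (Equiv.swap l l')
    have h1 := (gaussianRows_map (n := n) O).lintegral_comp (hmeas l)
    refine Eq.trans (lintegral_congr fun R => ?_) h1
    simp only [dualVec_map]
    have h2 : ∀ v : Vec m, O v l = v l' := fun v => by
      simp [O, LinearIsometryEquiv.piLpCongrLeft_apply, Equiv.piCongrLeft']
    simp only [h2]
  have htot : ∑ l' : Fin m, ∫⁻ R, ENNReal.ofReal (∑ i, (dualVec R i l') ^ 2) ∂(gaussianRows n m) ≤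
      ENNReal.ofReal (n * (1 / (m - n - 1))) := by
    rw [← lintegral_finsetSum _ fun l _ => hmeas l]
    have : ∀ R : Fin n → Vec m, ∑ l', ENNReal.ofReal (∑ i, (dualVec R i l') ^ 2) =
        ∑ i, ENNReal.ofReal (‖dualVec R i‖ ^ 2) := by
      intro R
      rw [← ENNReal.ofReal_sum_of_nonneg fun _ _ => by positivity, Finset.sum_comm,
        ENNReal.ofReal_sum_of_nonneg fun _ _ => by positivity]
      simp_rw [EuclideanSpace.real_norm_sq_eq]
    rw [lintegral_congr this, lintegral_finsetSum]
    · refine (Finset.sum_le_sum fun i _ => lintegral_norm_sq_dualVec_le hm i).trans (le_of_eq ?_)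
      rw [Finset.sum_const, Finset.card_univ, Fintype.card_fin, nsmul_eq_mul,
        ENNReal.ofReal_mul (by positivity), ENNReal.ofReal_natCast]
    · exact fun i _ => ENNReal.measurable_ofReal.comp ((measurable_dualVec i).norm.pow_const 2)
  rw [Finset.sum_congr rfl fun l' _ => hsymm l', Finset.sum_const, Finset.card_univ,
    Fintype.card_fin, nsmul_eq_mul] at htot
  have hm0 : (m : ℝ≥0∞) ≠ 0 := by
    have := l.2
    simp; omega
  rw [← ENNReal.mul_le_mul_iff_right hm0 (by simp)]
  refine htot.trans (le_of_eq ?_)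
  rw [← ENNReal.ofReal_natCast, ← ENNReal.ofReal_mul (by positivity)]
  congr 1
  have : (m : ℝ) - n - 1 ≠ 0 := by linarith
  have : (m : ℝ) ≠ 0 := by exact_mod_cast (by simpa using hm0)
  field_simp

/-! ### The risk of projecting onto a random span, and its lower bound -/

/-- The squared distance of `v` to the span of the vectors `w i`, as an infimum over coefficients:
in this form it is visibly upper semicontinuous in `w`, hence measurable. -/
noncomputable def distSq {n d : ℕ} (w : Fin n → Vec d) (v : Vec d) : ℝ≥0∞ :=
  ⨅ c : Fin n → ℝ, ENNReal.ofReal (‖v - ∑ i, c i • w i‖ ^ 2)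

theorem distSq_le {n d : ℕ} (w : Fin n → Vec d) (v : Vec d) (c : Fin n → ℝ) :
    distSq w v ≤ ENNReal.ofReal (‖v - ∑ i, c i • w i‖ ^ 2) := iInf_le _ c

theorem measurable_distSq {n d : ℕ} (v : Vec d) :
    Measurable fun w : Fin n → Vec d => distSq w v := by
  apply UpperSemicontinuous.measurable
  apply upperSemicontinuous_iInf
  intro c
  apply Continuous.upperSemicontinuous
  exact ENNReal.continuous_ofReal.comp (by fun_prop)

theorem distSq_le_smul {n d : ℕ} (w : Fin n → Vec d) (v : Vec d) (a : Fin n → ℝ) :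
    distSq w v ≤ distSq (fun i => a i • w i) v := by
  refine le_iInf fun c => (distSq_le w v fun i => c i * a i).trans (le_of_eq ?_)
  simp [mul_smul]

theorem distSq_smul {n d : ℕ} (w : Fin n → Vec d) (v : Vec d) {a : Fin n → ℝ}
    (ha : ∀ i, a i ≠ 0) : distSq (fun i => a i • w i) v = distSq w v := by
  refine le_antisymm ?_ (distSq_le_smul w v a)
  refine (distSq_le_smul (fun i => a i • w i) v fun i => (a i)⁻¹).trans (le_of_eq ?_)
  simp [smul_smul, ha]

/-- The linear map multiplying the `j`-th coordinate by `√(lam j)`. -/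
noncomputable def scaled {d : ℕ} (lam : Fin d → ℝ) : Vec d →L[ℝ] Vec d :=
  LinearMap.toContinuousLinearMap
    { toFun := fun u => WithLp.toLp 2 fun j => √(lam j) * u j
      map_add' := fun u v => by ext j; simp [mul_add]
      map_smul' := fun a u => by ext j; simp; ring }

theorem scaled_apply {d : ℕ} (lam : Fin d → ℝ) (u : Vec d) (j : Fin d) :
    scaled lam u j = √(lam j) * u j := rfl

/-- `Tr ((I - P) D)`, where `D` is the diagonal matrix of the `lam j` and `P` is the orthogonal
projection onto the span of the vectors `D^{1/2} (u i)`. -/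
noncomputable def spanRisk {n d : ℕ} (lam : Fin d → ℝ) (u : Fin n → Vec d) : ℝ≥0∞ :=
  ∑ j, ENNReal.ofReal (lam j) *
    distSq (fun i => scaled lam (u i)) (EuclideanSpace.single j 1)

theorem measurable_distSq_scaled {n d : ℕ} (lam : Fin d → ℝ) (v : Vec d) :
    Measurable fun u : Fin n → Vec d => distSq (fun i => scaled lam (u i)) v :=
  (measurable_distSq v).comp (by fun_prop)

theorem measurable_spanRisk {n d : ℕ} (lam : Fin d → ℝ) :
    Measurable fun u : Fin n → Vec d => spanRisk lam u :=
  Finset.measurable_sum _ fun _ _ => (measurable_distSq_scaled lam _).const_mul _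

/-- The expectation of `spanRisk` for independent directions that are uniform on the sphere. -/
noncomputable def meanSpanRisk {d : ℕ} (n : ℕ) (lam : Fin d → ℝ) : ℝ≥0∞ :=
  ∫⁻ u, spanRisk lam u ∂(Measure.pi fun _ : Fin n => uniformSphere d)

/-- As `spanRisk` depends only on the directions, uniform directions may be replaced by Gaussian
vectors, which have independent coordinates. -/
theorem meanSpanRisk_eq_gaussian {d : ℕ} (hd : 0 < d) (n : ℕ) (lam : Fin d → ℝ) :
    meanSpanRisk n lam = ∫⁻ g, spanRisk lam g ∂(gaussianRows n d) := by
  have hmp : MeasurePreserving (fun (g : Fin n → Vec d) i => ‖g i‖⁻¹ • g i)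
      (gaussianRows n d) (Measure.pi fun _ : Fin n => uniformSphere d) := by
    have := isProbabilityMeasure_uniformSphere hd
    exact measurePreserving_pi (fun _ => stdGaussian (Vec d)) (fun _ => uniformSphere d)
      (f := fun _ x => ‖x‖⁻¹ • x) fun _ => ⟨measurable_direction, stdGaussian_map_direction hd⟩
  rw [meanSpanRisk, ← hmp.lintegral_comp (measurable_spanRisk lam)]
  have hne : ∀ᵐ g ∂(gaussianRows n d), ∀ i, g i ≠ 0 := by
    rw [ae_all_iff]
    exact fun i => (measurePreserving_eval (fun _ : Fin n => stdGaussian (Vec d))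
      i).quasiMeasurePreserving.ae (stdGaussian_singleton_zero hd)
  refine lintegral_congr_ae ?_
  filter_upwards [hne] with g hg
  simp only [spanRisk, map_smul]
  congr 1
  ext j : 1
  rw [distSq_smul _ _ fun i => inv_ne_zero (norm_ne_zero_iff.2 (hg i))]

/-- A lower bound on the distance of a coordinate vector to the span, from a representation of the
corresponding column as a linear combination of other columns. The parameter `t` selects a tangent
line to the convex function `q ↦ 1 / (1 + lam j * q)`; the bound is affine in
`q = ∑ l, a l ^ 2 / lam (J l)`, so that it can be integrated. -/
theorem le_distSq_scaled {n d m : ℕ} {lam : Fin d → ℝ} {j : Fin d} (hj : 0 < lam j)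
    {J : Fin m → Fin d} (hJ : Function.Injective J) (hJj : ∀ l, J l ≠ j)
    (hpos : ∀ l, 0 < lam (J l)) (u : Fin n → Vec d) (a : Fin m → ℝ)
    (ha : ∀ i, ∑ l, a l * u i (J l) = u i j) (t : ℝ) :
    ENNReal.ofReal (2 * t - t ^ 2 * (1 + lam j * ∑ l, a l ^ 2 / lam (J l))) ≤
      distSq (fun i => scaled lam (u i)) (EuclideanSpace.single j 1) := by
  refine le_iInf fun c => ENNReal.ofReal_le_ofReal ?_
  set z : Vec d := EuclideanSpace.single j 1 - ∑ i, c i • scaled lam (u i) with hz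
  have hz1 : ∀ k, z k = (if k = j then 1 else 0) - √(lam k) * ∑ i, c i * u i k := by
    intro k
    simp [hz, scaled_apply, Finset.mul_sum]
    exact Finset.sum_congr rfl fun i _ => by ring
  let p : Fin m → ℝ := fun l => √(lam j) * a l / √(lam (J l))
  have hp : ∀ l, p l ^ 2 = lam j * (a l ^ 2 / lam (J l)) := by
    intro l
    simp only [p]
    rw [div_pow, mul_pow, Real.sq_sqrt hj.le, Real.sq_sqrt (hpos l).le, mul_div_assoc]
  -- The unknown coefficients `c` cancel from this combination of the residual's coordinates.
  have hsum : z j - ∑ l, p l * z (J l) = 1 := by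
    have h1 : ∀ l, p l * z (J l) = -(√(lam j) * ∑ i, c i * (a l * u i (J l))) := by
      intro l
      have := (Real.sqrt_pos.2 (hpos l)).ne'
      rw [hz1, if_neg (hJj l)]
      simp only [p]
      have h2 : ∑ i, c i * (a l * u i (J l)) = a l * ∑ i, c i * u i (J l) := by
        rw [Finset.mul_sum]
        exact Finset.sum_congr rfl fun i _ => by ring
      rw [h2]
      field_simp
      ring
    rw [Finset.sum_congr rfl fun l _ => h1 l, Finset.sum_neg_distrib, ← Finset.mul_sum,
      Finset.sum_comm]
    simp_rw [← Finset.mul_sum, ha]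
    rw [hz1, if_pos rfl]
    ring
  have hnorm : z j ^ 2 + ∑ l, z (J l) ^ 2 ≤ ‖z‖ ^ 2 := by
    rw [EuclideanSpace.real_norm_sq_eq, ← Finset.add_sum_erase _ _ (Finset.mem_univ j)]
    gcongr
    rw [← Finset.sum_image (s := Finset.univ) (g := J) (f := fun k => z k ^ 2) hJ.injOn]
    refine Finset.sum_le_sum_of_subset_of_nonneg ?_ fun _ _ _ => sq_nonneg _
    intro k hk
    obtain ⟨l, -, rfl⟩ := Finset.mem_image.1 hk
    simpa using hJj l
  have h3 : ∑ l, (z (J l) + t * p l) ^ 2 =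
      ∑ l, z (J l) ^ 2 + 2 * t * ∑ l, p l * z (J l) + t ^ 2 * ∑ l, p l ^ 2 := by
    simp_rw [Finset.mul_sum, ← Finset.sum_add_distrib]
    exact Finset.sum_congr rfl fun l _ => by ring
  have h4 : 0 ≤ ∑ l, (z (J l) + t * p l) ^ 2 := Finset.sum_nonneg fun _ _ => sq_nonneg _
  simp_rw [hp, ← Finset.mul_sum] at h3
  have h5 : 2 * t * z j - 2 * t * ∑ l, p l * z (J l) = 2 * t := by
    linear_combination 2 * t * hsum
  have h6 : 0 ≤ z j ^ 2 - 2 * t * z j + t ^ 2 := by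
    rw [show z j ^ 2 - 2 * t * z j + t ^ 2 = (z j - t) ^ 2 by ring]
    positivity
  linarith

/-- Splitting off one coordinate and selecting `m` others makes a standard Gaussian vector a pair
of independent standard Gaussians. -/
theorem measurePreserving_select {d m : ℕ} {j : Fin d}
    {J : Fin m → Fin d} (hJ : Function.Injective J) (hJj : ∀ l, J l ≠ j) :
    MeasurePreserving (fun x : Vec d => (x j, (WithLp.toLp 2 fun l => x (J l) : Vec m)))
      (stdGaussian (Vec d)) ((gaussianReal 0 1).prod (stdGaussian (Vec m))) := by
  have hι : Function.Injective (Fin.cons j J : Fin (m + 1) → Fin d) := by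
    rw [Fin.cons_injective_iff]
    exact ⟨fun ⟨l, hl⟩ => hJj l hl, hJ⟩
  have h1 : MeasurePreserving (fun x : Vec d => (x.ofLp : Fin d → ℝ)) (stdGaussian (Vec d))
      (Measure.pi fun _ => gaussianReal 0 1) := by
    refine ⟨by fun_prop, ?_⟩
    rw [← map_pi_eq_stdGaussian, Measure.map_map (by fun_prop) (by fun_prop)]
    exact Measure.map_id
  have h2 : MeasurePreserving (fun (x : Fin d → ℝ) i => x ((Fin.cons j J : Fin (m + 1) → Fin d) i))
      (Measure.pi fun _ => gaussianReal 0 1) (Measure.pi fun _ => gaussianReal 0 1) := by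
    refine ⟨by fun_prop, ?_⟩
    have := (iIndepFun_pi (μ := fun _ : Fin d => gaussianReal 0 1) (X := fun _ x => x)
      fun _ => by fun_prop).precomp hι
    rw [iIndepFun_iff_map_fun_eq_pi_map fun _ => (measurable_pi_apply _).aemeasurable] at this
    rw [this]
    congr 1
    ext i : 1
    exact (measurePreserving_eval (fun _ : Fin d => gaussianReal 0 1) _).map_eq
  have h3 := measurePreserving_piFinSuccAbove (fun _ : Fin (m + 1) => gaussianReal 0 1) 0
  have h4 : MeasurePreserving (WithLp.toLp 2 : (Fin m → ℝ) → Vec m)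
      (Measure.pi fun _ => gaussianReal 0 1) (stdGaussian (Vec m)) :=
    ⟨by fun_prop, map_pi_eq_stdGaussian⟩
  have h5 := ((MeasurePreserving.id (gaussianReal 0 1)).prod h4).comp (h3.comp (h2.comp h1))
  exact h5

theorem measurePreserving_select_rows (n : ℕ) {d m : ℕ} {j : Fin d}
    {J : Fin m → Fin d} (hJ : Function.Injective J) (hJj : ∀ l, J l ≠ j) :
    MeasurePreserving (fun g : Fin n → Vec d => ((WithLp.toLp 2 fun i => g i j : Vec n),
      fun i => (WithLp.toLp 2 fun l => g i (J l) : Vec m)))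
      (gaussianRows n d) ((stdGaussian (Vec n)).prod (gaussianRows n m)) := by
  have h1 := measurePreserving_pi (fun _ : Fin n => stdGaussian (Vec d)) _
    fun _ => measurePreserving_select hJ hJj
  have h2 := measurePreserving_arrowProdEquivProdArrow ℝ (Vec m) (Fin n)
    (fun _ => gaussianReal 0 1) (fun _ => stdGaussian (Vec m))
  have h4 : MeasurePreserving (WithLp.toLp 2 : (Fin n → ℝ) → Vec n)
      (Measure.pi fun _ => gaussianReal 0 1) (stdGaussian (Vec n)) :=
    ⟨by fun_prop, map_pi_eq_stdGaussian⟩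
  exact (h4.prod (MeasurePreserving.id (gaussianRows n m))).comp (h2.comp h1)

theorem lintegral_inner_sq_stdGaussian {n : ℕ} (b : Vec n) :
    ∫⁻ y, ENNReal.ofReal (inner ℝ b y ^ 2) ∂(stdGaussian (Vec n)) = ENNReal.ofReal (‖b‖ ^ 2) := by
  have h : MemLp (fun y : Vec n => inner ℝ b y) 2 (stdGaussian (Vec n)) :=
    IsGaussian.memLp_two_id.const_inner b
  rw [← ofReal_integral_eq_lintegral_ofReal h.integrable_sq
    (Filter.Eventually.of_forall fun _ => sq_nonneg _)]
  congr 1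
  have h1 := variance_dual_stdGaussian (innerSL ℝ b)
  have h2 := integral_strongDual_stdGaussian (innerSL ℝ b)
  rw [variance_of_integral_eq_zero (by fun_prop) h2] at h1
  simpa using h1

/-- The coefficients of the representation of the column `y` as a linear combination of the columns
of the matrix with rows `R`. -/
noncomputable def columnCoeff {n m : ℕ} (y : Vec n) (R : Fin n → Vec m) (l : Fin m) : ℝ :=
  ∑ i, y i * dualVec R i l

theorem sum_columnCoeff_mul {n m : ℕ} (y : Vec n) {R : Fin n → Vec m}
    (hR : LinearIndependent ℝ R) (k : Fin n) :
    ∑ l, columnCoeff y R l * R k l = y k := by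
  have h : ∀ i, ∑ l, dualVec R i l * R k l = if i = k then 1 else 0 := by
    intro i
    rw [← inner_dualVec (Matrix.det_gram_ne_zero_iff_linearIndependent.2 hR) i k]
    simp [PiLp.inner_apply, mul_comm]
  simp_rw [columnCoeff, Finset.sum_mul, mul_assoc]
  rw [Finset.sum_comm]
  simp_rw [← Finset.mul_sum, h]
  simp

theorem measurable_columnCoeff {n m : ℕ} (l : Fin m) :
    Measurable fun p : Vec n × (Fin n → Vec m) => columnCoeff p.1 p.2 l := by
  refine Finset.measurable_sum _ fun i _ => Measurable.mul ?_ ?_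
  · exact (EuclideanSpace.proj (𝕜 := ℝ) i).continuous.measurable.comp measurable_fst
  · exact (EuclideanSpace.proj (𝕜 := ℝ) l).continuous.measurable.comp
      ((measurable_dualVec i).comp measurable_snd)

/-- Given the rows `R`, the column `y` is standard Gaussian, so integrating it out leaves the
squared coordinates of the dual vectors. -/
theorem lintegral_columnCoeff_sq_le {n m : ℕ} (hm : n + 2 ≤ m) (l : Fin m) :
    ∫⁻ p, ENNReal.ofReal (columnCoeff p.1 p.2 l ^ 2)
      ∂((stdGaussian (Vec n)).prod (gaussianRows n m)) ≤
      ENNReal.ofReal (n / (m * (m - n - 1))) := by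
  rw [lintegral_prod_symm' (fun p => ENNReal.ofReal (columnCoeff p.1 p.2 l ^ 2))
    (ENNReal.measurable_ofReal.comp ((measurable_columnCoeff l).pow_const 2))]
  refine le_trans (le_of_eq (lintegral_congr fun R => ?_)) (lintegral_sum_dualVec_sq_le hm l)
  have := lintegral_inner_sq_stdGaussian (WithLp.toLp 2 fun i => dualVec R i l : Vec n)
  rw [EuclideanSpace.real_norm_sq_eq] at this
  simpa [columnCoeff, PiLp.inner_apply] using this

/-- Integrated form of `le_distSq_scaled`: the selected columns represent the `j`-th one by
`columnCoeff`, whose second moments are bounded by `lintegral_columnCoeff_sq_le`. -/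
theorem le_lintegral_distSq_scaled {n d m : ℕ} {lam : Fin d → ℝ} {j : Fin d} (hj : 0 < lam j)
    {J : Fin m → Fin d} (hJ : Function.Injective J) (hJj : ∀ l, J l ≠ j)
    (hpos : ∀ l, 0 < lam (J l)) (hm : n + 2 ≤ m) {q : ℝ}
    (hq : n / (m * (m - n - 1)) * ∑ l, (lam (J l))⁻¹ ≤ q) :
    ENNReal.ofReal (1 / (1 + lam j * q)) ≤
      ∫⁻ g, distSq (fun i => scaled lam (g i)) (EuclideanSpace.single j 1)
        ∂(gaussianRows n d) := by
  have hm' : (n : ℝ) + 2 ≤ m := by exact_mod_cast hm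
  have hc : 0 ≤ (n : ℝ) / (m * (m - n - 1)) :=
    div_nonneg (by positivity) (mul_nonneg (by positivity) (by linarith))
  have hq0 : 0 ≤ q := le_trans
    (mul_nonneg hc (Finset.sum_nonneg fun l _ => (inv_pos.2 (hpos l)).le)) hq
  -- The tangent line is taken at the bound `q` on the mean.
  set t := 1 / (1 + lam j * q) with ht
  have hden : 0 < 1 + lam j * q := by positivity
  have ht0 : 0 < t := by positivity
  have ht1 : t * (1 + lam j * q) = 1 := by rw [ht]; field_simp
  let Q : Vec n × (Fin n → Vec m) → ℝ := fun p => ∑ l, columnCoeff p.1 p.2 l ^ 2 / lam (J l)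
  have hQ0 : ∀ p, 0 ≤ Q p := fun p => Finset.sum_nonneg fun l _ =>
    div_nonneg (sq_nonneg _) (hpos l).le
  have hQm : Measurable Q := Finset.measurable_sum _ fun l _ =>
    ((measurable_columnCoeff l).pow_const 2).div_const _
  have hQint : ∫⁻ p, ENNReal.ofReal (Q p) ∂((stdGaussian (Vec n)).prod (gaussianRows n m)) ≤
      ENNReal.ofReal q := by
    have h1 : ∀ p, ENNReal.ofReal (Q p) = ∑ l, ENNReal.ofReal (lam (J l))⁻¹ *
        ENNReal.ofReal (columnCoeff p.1 p.2 l ^ 2) := by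
      intro p
      rw [ENNReal.ofReal_sum_of_nonneg fun l _ => div_nonneg (sq_nonneg _) (hpos l).le]
      refine Finset.sum_congr rfl fun l _ => ?_
      rw [← ENNReal.ofReal_mul (inv_pos.2 (hpos l)).le]
      congr 1
      ring
    have h2 : ∀ l, Measurable fun p : Vec n × (Fin n → Vec m) =>
        ENNReal.ofReal (columnCoeff p.1 p.2 l ^ 2) := fun l =>
      ENNReal.measurable_ofReal.comp ((measurable_columnCoeff l).pow_const 2)
    rw [lintegral_congr h1, lintegral_finsetSum _ fun l _ => (h2 l).const_mul _]
    calc ∑ l, ∫⁻ p, ENNReal.ofReal (lam (J l))⁻¹ * ENNReal.ofReal (columnCoeff p.1 p.2 l ^ 2)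
          ∂((stdGaussian (Vec n)).prod (gaussianRows n m))
        ≤ ∑ l, ENNReal.ofReal (lam (J l))⁻¹ * ENNReal.ofReal (n / (m * (m - n - 1))) := by
          refine Finset.sum_le_sum fun l _ => ?_
          rw [lintegral_const_mul _ (h2 l)]
          gcongr
          exact lintegral_columnCoeff_sq_le hm l
      _ = ENNReal.ofReal (n / (m * (m - n - 1)) * ∑ l, (lam (J l))⁻¹) := by
          rw [← Finset.sum_mul, ← ENNReal.ofReal_sum_of_nonneg fun l _ => (inv_pos.2 (hpos l)).le,
            ← ENNReal.ofReal_mul (Finset.sum_nonneg fun l _ => (inv_pos.2 (hpos l)).le), mul_comm]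
      _ ≤ ENNReal.ofReal q := ENNReal.ofReal_le_ofReal hq
  have hmp := measurePreserving_select_rows n hJ hJj
  have hLI : ∀ᵐ p ∂((stdGaussian (Vec n)).prod (gaussianRows n m)), LinearIndependent ℝ p.2 :=
    Measure.quasiMeasurePreserving_snd.ae (ae_linearIndependent hm)
  calc ENNReal.ofReal t
      = ENNReal.ofReal (2 * t - t ^ 2) - ENNReal.ofReal (t ^ 2 * lam j) * ENNReal.ofReal q := by
        rw [← ENNReal.ofReal_mul (by positivity), ← ENNReal.ofReal_sub _ (by positivity)]
        congr 1
        linear_combination t * ht1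
    _ ≤ ∫⁻ _, ENNReal.ofReal (2 * t - t ^ 2) ∂((stdGaussian (Vec n)).prod (gaussianRows n m)) -
        ∫⁻ p, ENNReal.ofReal (t ^ 2 * lam j) * ENNReal.ofReal (Q p)
          ∂((stdGaussian (Vec n)).prod (gaussianRows n m)) := by
        rw [lintegral_const, measure_univ, mul_one, lintegral_const_mul _ (by fun_prop)]
        gcongr
    _ ≤ ∫⁻ p, (ENNReal.ofReal (2 * t - t ^ 2) - ENNReal.ofReal (t ^ 2 * lam j) *
          ENNReal.ofReal (Q p)) ∂((stdGaussian (Vec n)).prod (gaussianRows n m)) :=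
        lintegral_sub_le _ _ (by fun_prop)
    _ = ∫⁻ g, _ ∂(gaussianRows n d) := (hmp.lintegral_comp (by fun_prop)).symm
    _ ≤ _ := by
        refine lintegral_mono_ae ?_
        filter_upwards [hmp.quasiMeasurePreserving.ae hLI] with g hg
        have := le_distSq_scaled hj hJ hJj hpos g _ (sum_columnCoeff_mul
          (WithLp.toLp 2 fun i => g i j) hg) t
        refine le_trans (le_of_eq ?_) this
        rw [← ENNReal.ofReal_mul (by positivity),
          ← ENNReal.ofReal_sub _ (mul_nonneg (by positivity) (hQ0 _))]
        congr 1
        simp only [Q]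
        ring

/-! ### Eigenvalues and the choice of the noise level -/

theorem exists_sum_smul_eq_starProjection {n d : ℕ} (w : Fin n → Vec d) (v : Vec d) :
    ∃ c : Fin n → ℝ, v - ∑ i, c i • w i =
      (Submodule.span ℝ (Set.range w))ᗮ.starProjection v := by
  obtain ⟨c, hc⟩ := (Submodule.mem_span_range_iff_exists_fun ℝ).1
    ((Submodule.span ℝ (Set.range w)).starProjection_apply_mem v)
  refine ⟨c, ?_⟩
  rw [hc, Submodule.starProjection_orthogonal_val]

theorem starProjection_orthogonal_sub_sum {n d : ℕ} (w : Fin n → Vec d) (v : Vec d)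
    (c : Fin n → ℝ) : (Submodule.span ℝ (Set.range w))ᗮ.starProjection (v - ∑ i, c i • w i) =
      (Submodule.span ℝ (Set.range w))ᗮ.starProjection v := by
  rw [map_sub, Submodule.starProjection_orthogonal_apply_eq_zero (v := ∑ i, c i • w i), sub_zero]
  exact Submodule.sum_mem _ fun i _ => Submodule.smul_mem _ _ (Submodule.subset_span ⟨i, rfl⟩)

theorem distSq_eq_norm_sq {n d : ℕ} (w : Fin n → Vec d) (v : Vec d) :
    distSq w v = ENNReal.ofReal (‖(Submodule.span ℝ (Set.range w))ᗮ.starProjection v‖ ^ 2) := by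
  apply le_antisymm
  · obtain ⟨c, hc⟩ := exists_sum_smul_eq_starProjection w v
    rw [← hc]
    exact distSq_le w v c
  · refine le_iInf fun c => ENNReal.ofReal_le_ofReal ?_
    rw [← starProjection_orthogonal_sub_sum w v c]
    gcongr
    exact Submodule.norm_starProjection_apply_le _ _

/-- Fewer vectors than positive diagonal entries cannot span the range of the diagonal matrix. -/
theorem spanRisk_pos {n d : ℕ} {lam : Fin d → ℝ}
    (h : n < Fintype.card {j // 0 < lam j}) (u : Fin n → Vec d) : 0 < spanRisk lam u := by
  rw [pos_iff_ne_zero]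
  intro h0
  rw [spanRisk, Finset.sum_eq_zero_iff] at h0
  set V := Submodule.span ℝ (Set.range fun i => scaled lam (u i)) with hV
  have hmem : ∀ j : {j // 0 < lam j}, (EuclideanSpace.single j.1 1 : Vec d) ∈ V := by
    intro j
    have h1 := h0 j.1 (Finset.mem_univ _)
    rw [mul_eq_zero, ENNReal.ofReal_eq_zero, distSq_eq_norm_sq, ENNReal.ofReal_eq_zero] at h1
    have h2 := h1.resolve_left (not_le.2 j.2)
    have h3 : Vᗮ.starProjection (EuclideanSpace.single j.1 1 : Vec d) = 0 := by
      rw [← norm_eq_zero]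
      exact pow_eq_zero_iff two_ne_zero |>.1 (le_antisymm h2 (sq_nonneg _))
    rw [Submodule.starProjection_apply_eq_zero_iff, Submodule.orthogonal_orthogonal] at h3
    exact h3
  have hli : LinearIndependent ℝ fun j : {j // 0 < lam j} =>
      (EuclideanSpace.single j.1 1 : Vec d) := by
    have := (EuclideanSpace.basisFun (Fin d) ℝ).orthonormal.linearIndependent.comp _
      (Subtype.val_injective (p := fun j => 0 < lam j))
    simpa [Function.comp_def] using this
  have h4 : Submodule.span ℝ (Set.range fun j : {j // 0 < lam j} =>
      (EuclideanSpace.single j.1 1 : Vec d)) ≤ V := by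
    rw [Submodule.span_le]
    rintro _ ⟨j, rfl⟩
    exact hmem j
  have h5 := Submodule.finrank_mono h4
  rw [finrank_span_eq_card hli] at h5
  have h6 : Module.finrank ℝ V ≤ n :=
    (finrank_range_le_card (R := ℝ) fun i => scaled lam (u i)).trans (by simp)
  exact (h.trans_le (h5.trans h6)).false

theorem meanSpanRisk_pos {n d : ℕ} (hd : 0 < d) {lam : Fin d → ℝ}
    (h : n < Fintype.card {j // 0 < lam j}) : 0 < meanSpanRisk n lam := by
  have := isProbabilityMeasure_uniformSphere hd
  rw [meanSpanRisk, lintegral_pos_iff_support (measurable_spanRisk lam)]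
  have : Function.support (fun u : Fin n → Vec d => spanRisk lam u) = Set.univ :=
    Set.eq_univ_of_forall fun u => (spanRisk_pos h u).ne'
  rw [this]
  simp

/-- Among `m + 1` positive weights in decreasing order, one can select `m` of them that avoid a
given index, with sum of inverses at most that of the `m` smallest weights. -/
theorem exists_select {d m : ℕ} {lam : Fin d → ℝ} {top : Fin (m + 1) → Fin d}
    (htop : Function.Injective top) (hanti : ∀ t, lam (top t) ≤ lam (top 0))
    (hpos : ∀ t, 0 < lam (top t)) (j : Fin d) :
    ∃ J : Fin m → Fin d, Function.Injective J ∧ (∀ l, J l ≠ j) ∧ (∀ l, 0 < lam (J l)) ∧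
      ∑ l, (lam (J l))⁻¹ ≤ ∑ l : Fin m, (lam (top l.succ))⁻¹ := by
  by_cases hj : ∃ t, top t = j
  · obtain ⟨t, rfl⟩ := hj
    refine ⟨fun l => top (t.succAbove l), htop.comp (Fin.succAbove_right_injective),
      fun l h => Fin.succAbove_ne t l (htop h), fun l => hpos _, ?_⟩
    have h1 := Fin.sum_univ_succAbove (fun s => (lam (top s))⁻¹) t
    have h2 := Fin.sum_univ_succ (fun s => (lam (top s))⁻¹)
    have h3 : (lam (top 0))⁻¹ ≤ (lam (top t))⁻¹ := inv_anti₀ (hpos t) (hanti t)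
    linarith
  · push Not at hj
    exact ⟨fun l => top l.succ, htop.comp (Fin.succ_injective _), fun l => hj _, fun l => hpos _,
      le_rfl⟩

/-- The lower bound `μ * df1` on the mean risk, from the `m + 1` largest eigenvalues. For each index
`j`, the `m` columns used to represent the `j`-th one are chosen by `exists_select`. -/
theorem le_meanSpanRisk {n d m : ℕ} (hn : 0 < n) {lam : Fin d → ℝ} (hlam : ∀ j, 0 ≤ lam j)
    {top : Fin (m + 1) → Fin d}
    (htop : Function.Injective top) (hanti : ∀ t, lam (top t) ≤ lam (top 0))
    (hpos : ∀ t, 0 < lam (top t)) (hm : n + 2 ≤ m) {μ : ℝ}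
    (hμ : μ = m * (m - n - 1) * (∑ l : Fin m, (lam (top l.succ))⁻¹)⁻¹ / n) :
    ENNReal.ofReal (∑ j, lam j * (μ / (lam j + μ))) ≤ meanSpanRisk n lam := by
  have hm' : (n : ℝ) + 2 ≤ m := by exact_mod_cast hm
  have hn' : (0 : ℝ) < n := by exact_mod_cast hn
  have hm1 : (0 : ℝ) < m - n - 1 := by linarith
  have hm0 : (0 : ℝ) < m := by linarith
  have hsum : 0 < ∑ l : Fin m, (lam (top l.succ))⁻¹ := by
    have : Nonempty (Fin m) := ⟨⟨0, by omega⟩⟩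
    exact Finset.sum_pos (fun l _ => inv_pos.2 (hpos _)) Finset.univ_nonempty
  have hμ0 : 0 < μ := by rw [hμ]; positivity
  rw [meanSpanRisk_eq_gaussian (top 0).pos]
  simp only [spanRisk]
  rw [lintegral_finsetSum _ fun j _ => (measurable_distSq_scaled lam _).const_mul _,
    ENNReal.ofReal_sum_of_nonneg fun j _ => mul_nonneg (hlam j)
      (div_nonneg hμ0.le (add_nonneg (hlam j) hμ0.le))]
  refine Finset.sum_le_sum fun j _ => ?_
  rw [lintegral_const_mul _ (measurable_distSq_scaled lam _), ENNReal.ofReal_mul (hlam j)]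
  rcases (hlam j).eq_or_lt with h0 | hj
  · simp [← h0]
  gcongr
  obtain ⟨J, hJ, hJj, hJpos, hJsum⟩ := exists_select htop hanti hpos j
  have := le_lintegral_distSq_scaled (n := n) hj hJ hJj hJpos hm (q := 1 / μ) ?_
  · refine le_trans (le_of_eq ?_) this
    congr 1
    field_simp
    ring
  · calc _ ≤ n / (m * (m - n - 1)) * ∑ l : Fin m, (lam (top l.succ))⁻¹ := by gcongr
      _ = 1 / μ := by
        rw [hμ]
        field_simp

/-- The spectral form of `μ * df1 S μ`. It also holds for `μ = 0`, where the inverse in `df1` may be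
that of a singular matrix. -/
theorem mul_df1_eq {d : ℕ} {S : Matrix (Fin d) (Fin d) ℝ} (hS : S.PosSemidef) {μ : ℝ}
    (hμ : 0 ≤ μ) : μ * df1 S μ =
      ∑ j, hS.isHermitian.eigenvalues j * (μ / (hS.isHermitian.eigenvalues j + μ)) := by
  rcases hμ.eq_or_lt with rfl | hμ
  · simp
  set lam := hS.isHermitian.eigenvalues with hlam
  have hpos : ∀ j, 0 < lam j + μ := fun j => add_pos_of_nonneg_of_pos (hS.eigenvalues_nonneg j) hμ
  let φ := Unitary.conjStarAlgAut ℝ (Matrix (Fin d) (Fin d) ℝ) hS.isHermitian.eigenvectorUnitary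
  have hspec : S = φ (Matrix.diagonal lam) := hS.isHermitian.spectral_theorem
  have htr : ∀ A, (φ A).trace = A.trace := by
    intro A
    rw [Unitary.conjStarAlgAut_apply, Matrix.trace_mul_comm, ← mul_assoc]
    simp
  have hadd : S + μ • 1 = φ (Matrix.diagonal fun j => lam j + μ) := by
    conv_lhs => rw [hspec, ← map_one φ, ← map_smul, ← map_add]
    congr 1
    ext i j
    by_cases h : i = j <;> simp [h]
  have hinv : (S + μ • 1)⁻¹ = φ (Matrix.diagonal fun j => (lam j + μ)⁻¹) := by
    apply Matrix.inv_eq_right_inv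
    rw [hadd, ← map_mul, Matrix.diagonal_mul_diagonal]
    have : (fun j => (lam j + μ) * (lam j + μ)⁻¹) = fun _ => 1 := by
      ext j
      exact mul_inv_cancel₀ (hpos j).ne'
    rw [this, Matrix.diagonal_one, map_one]
  rw [df1, hinv]
  conv_lhs => rw [hspec]
  rw [← map_mul, htr, Matrix.diagonal_mul_diagonal, Matrix.trace_diagonal, Finset.mul_sum]
  exact Finset.sum_congr rfl fun j _ => by ring

/-- The `m + 1` largest eigenvalues, as an enumeration of the index set of the eigenvalues. -/
theorem exists_top_eigenvalues {d m : ℕ} {S : Matrix (Fin d) (Fin d) ℝ} (hS : S.IsHermitian)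
    (hm : m + 1 ≤ d) (hpos : 0 < eig hS (m + 1)) :
    ∃ top : Fin (m + 1) → Fin d, Function.Injective top ∧
      (∀ t, hS.eigenvalues (top t) ≤ hS.eigenvalues (top 0)) ∧
      (∀ t, 0 < hS.eigenvalues (top t)) ∧
      ∑ l : Fin m, (hS.eigenvalues (top l.succ))⁻¹ =
        ∑ j ∈ Finset.Icc 2 (m + 1), (eig hS j)⁻¹ := by
  let ε : Fin (Fintype.card (Fin d)) ≃ Fin d := Fintype.equivOfCardEq (Fintype.card_fin _)
  let emb : Fin (m + 1) → Fin (Fintype.card (Fin d)) :=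
    Fin.castLE (by rw [Fintype.card_fin]; exact hm)
  have hval : ∀ t : Fin (m + 1), hS.eigenvalues (ε (emb t)) = hS.eigenvalues₀ (emb t) := by
    intro t
    simp [Matrix.IsHermitian.eigenvalues, ε]
  have heig : ∀ t : Fin (m + 1), eig hS (t + 1) = hS.eigenvalues₀ (emb t) := by
    intro t
    have := t.2
    rw [eig, dif_pos ⟨by omega, by omega⟩]
    rfl
  refine ⟨fun t => ε (emb t), ε.injective.comp (Fin.castLE_injective _), fun t => ?_, fun t => ?_,
    ?_⟩
  · rw [hval, hval]
    exact hS.eigenvalues₀_antitone (Fin.zero_le t)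
  · rw [hval]
    refine (lt_of_lt_of_eq hpos (heig (Fin.last m))).trans_le ?_
    exact hS.eigenvalues₀_antitone (Fin.le_last t)
  · rw [← Finset.Ico_add_one_right_eq_Icc, Finset.sum_Ico_eq_sum_range, Finset.sum_range]
    refine Finset.sum_congr rfl fun l _ => ?_
    rw [hval, ← heig]
    congr 2
    simp
    ring

/-- The number `σ₀²` is the largest of the values required for the various `k` and of one more
value: a positive one when the rank exceeds `n`, as the mean risk is then positive, and
zero otherwise. -/
theorem exists_noise_level {n d : ℕ} (hn : 0 < n) (hd : n + 2 < d)
    {S : Matrix (Fin d) (Fin d) ℝ} (hS : S.PosSemidef) :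
    ∃ σ₀sq : ℝ, 0 ≤ σ₀sq ∧ (n < S.rank → 0 < σ₀sq) ∧
      (∀ k : ℕ, n + 2 < k → k ≤ d → 0 < eig hS.isHermitian k →
        ((k : ℝ) - 1) * ((k : ℝ) - n - 2) *
            (∑ j ∈ Finset.Icc 2 k, (eig hS.isHermitian j)⁻¹)⁻¹ ≤ σ₀sq) ∧
      ENNReal.ofReal (σ₀sq / n * df1 S (σ₀sq / n)) ≤
        meanSpanRisk n hS.isHermitian.eigenvalues := by
  classical
  have hn' : (0 : ℝ) < n := by exact_mod_cast hn
  have hd' : (0 : ℝ) < d := by exact_mod_cast (by omega)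
  set lam := hS.isHermitian.eigenvalues with hlam
  have hlam0 : ∀ j, 0 ≤ lam j := hS.eigenvalues_nonneg
  let val : ℕ → ℝ := fun k => ((k : ℝ) - 1) * ((k : ℝ) - n - 2) *
    (∑ j ∈ Finset.Icc 2 k, (eig hS.isHermitian j)⁻¹)⁻¹
  let K := (Finset.Icc (n + 3) d).filter fun k => 0 < eig hS.isHermitian k
  obtain ⟨s, hs0, hspos, hs⟩ : ∃ s : ℝ, 0 ≤ s ∧ (n < S.rank → 0 < s) ∧
      ENNReal.ofReal (s / n * df1 S (s / n)) ≤ meanSpanRisk n lam := by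
    by_cases hr : n < S.rank
    · have hcard : n < Fintype.card {j // 0 < lam j} := by
        rw [hS.isHermitian.rank_eq_card_non_zero_eigs] at hr
        convert hr using 1
        exact Fintype.card_congr (Equiv.subtypeEquivRight fun j => (hlam0 j).lt_iff_ne')
      have hM := meanSpanRisk_pos (by omega) hcard
      -- As `μ * df1 S μ ≤ d * μ`, any `μ ≤ meanSpanRisk / d` is admissible.
      set x := (min (meanSpanRisk n lam) 1).toReal with hx
      have hx0 : 0 < x := ENNReal.toReal_pos (lt_min hM one_pos).ne'
        ((min_le_right _ _).trans_lt ENNReal.one_lt_top).ne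
      refine ⟨n * (x / d), by positivity, fun _ => by positivity, ?_⟩
      rw [mul_div_cancel_left₀ _ hn'.ne', mul_df1_eq hS (by positivity)]
      calc _ ≤ ENNReal.ofReal x := by
            apply ENNReal.ofReal_le_ofReal
            calc _ ≤ ∑ _j : Fin d, x / d := by
                  refine Finset.sum_le_sum fun j _ => ?_
                  have h1 : 0 < x / d := by positivity
                  rw [← mul_div_assoc, div_le_iff₀ (add_pos_of_nonneg_of_pos (hlam0 j) h1)]
                  nlinarith [hlam0 j]
              _ = x := by
                  rw [Finset.sum_const, Finset.card_univ, Fintype.card_fin, nsmul_eq_mul]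
                  field_simp
        _ = min (meanSpanRisk n lam) 1 :=
            ENNReal.ofReal_toReal ((min_le_right _ _).trans_lt ENNReal.one_lt_top).ne
        _ ≤ _ := min_le_left _ _
    · exact ⟨0, le_rfl, fun h => absurd h hr, by simp⟩
  obtain ⟨σ, hσmem, hσmax⟩ := (insert s (K.image val)).exists_max_image id ⟨s, by simp⟩
  have hsσ : s ≤ σ := hσmax s (by simp)
  refine ⟨σ, hs0.trans hsσ, fun h => (hspos h).trans_le hsσ, fun k hk hkd hpos => ?_, ?_⟩
  · refine hσmax (val k) (Finset.mem_insert_of_mem (Finset.mem_image_of_mem _ ?_))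
    exact Finset.mem_filter.2 ⟨Finset.mem_Icc.2 ⟨hk, hkd⟩, hpos⟩
  · rcases Finset.mem_insert.1 hσmem with rfl | h
    · exact hs
    obtain ⟨k, hk, rfl⟩ := Finset.mem_image.1 h
    obtain ⟨hk, hpos⟩ := Finset.mem_filter.1 hk
    rw [Finset.mem_Icc] at hk
    obtain ⟨m, rfl⟩ : ∃ m, k = m + 1 := ⟨k - 1, by omega⟩
    obtain ⟨top, htop, hanti, htpos, hsum⟩ := exists_top_eigenvalues hS.isHermitian hk.2 hpos
    rw [mul_df1_eq hS (div_nonneg (hs0.trans hsσ) hn'.le)]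
    refine le_meanSpanRisk hn hlam0 htop hanti htpos (by omega) ?_
    rw [hsum]
    simp only [val]
    push_cast
    congr 3 <;> ring

/-! ### The averaged risk of a linear rule without noise -/

section SecondMoment

variable {d : ℕ}

theorem integrable_inner_mul_inner {μ : Measure (Vec d)} (hμ : MemLp id 2 μ) (v w : Vec d) :
    Integrable (fun x => inner ℝ v x * inner ℝ w x) μ :=
  MemLp.integrable_mul (hμ.const_inner v) (hμ.const_inner w)

theorem integral_inner_mul_inner {μ : Measure (Vec d)} (hμ : MemLp id 2 μ) (v w : Vec d) :
    ∫ x, inner ℝ v x * inner ℝ w x ∂μ =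
      inner ℝ v (Matrix.toEuclideanCLM (𝕜 := ℝ) (secondMoment μ) w) := by
  have h1 : ∀ i j, Integrable (fun x : Vec d => x i * x j) μ := by
    intro i j
    simpa [EuclideanSpace.inner_single_left] using integrable_inner_mul_inner hμ
      (EuclideanSpace.single i 1) (EuclideanSpace.single j 1)
  have h2 : ∀ x : Vec d, inner ℝ v x * inner ℝ w x = ∑ i, ∑ j, v i * w j * (x i * x j) := by
    intro x
    simp only [PiLp.inner_apply, Finset.sum_mul_sum, RCLike.inner_apply, conj_trivial]
    exact Finset.sum_congr rfl fun i _ => Finset.sum_congr rfl fun j _ => by ring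
  simp_rw [h2]
  rw [integral_finsetSum _ fun i _ => integrable_finsetSum _ fun j _ => (h1 i j).const_mul _]
  simp_rw [integral_finsetSum Finset.univ fun j _ => (h1 _ j).const_mul _, integral_const_mul]
  simp only [PiLp.inner_apply, Matrix.ofLp_toEuclideanCLM, Matrix.mulVec, dotProduct,
    secondMoment, Matrix.of_apply, RCLike.inner_apply, conj_trivial, Finset.sum_mul]
  exact Finset.sum_congr rfl fun i _ => Finset.sum_congr rfl fun j _ => by ring

theorem posSemidef_secondMoment {μ : Measure (Vec d)} (hμ : MemLp id 2 μ) :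
    (secondMoment μ).PosSemidef := by
  refine Matrix.PosSemidef.of_dotProduct_mulVec_nonneg ?_ fun x => ?_
  · ext i j
    simp [secondMoment, mul_comm]
  · have h := integral_inner_mul_inner hμ (WithLp.toLp 2 x) (WithLp.toLp 2 x)
    have h2 : 0 ≤
        ∫ y, inner ℝ (WithLp.toLp 2 x : Vec d) y * inner ℝ (WithLp.toLp 2 x : Vec d) y ∂μ :=
      integral_nonneg fun y => mul_self_nonneg _
    rw [h, Matrix.inner_toEuclideanCLM] at h2
    simpa using h2

/-- The square root of a matrix, as an operator. -/
noncomputable def sqrtOp (M : Matrix (Fin d) (Fin d) ℝ) : Vec d →L[ℝ] Vec d :=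
  Matrix.toEuclideanCLM (𝕜 := ℝ) (CFC.sqrt M)

theorem inner_sqrtOp (M : Matrix (Fin d) (Fin d) ℝ) (v w : Vec d) :
    inner ℝ (sqrtOp M v) w = inner ℝ v (sqrtOp M w) := by
  have h : IsSelfAdjoint (sqrtOp M) := (CFC.sqrt_nonneg M).isSelfAdjoint.map _
  exact h.isSymmetric v w

theorem sqrtOp_sqrtOp {M : Matrix (Fin d) (Fin d) ℝ} (hM : M.PosSemidef) (v : Vec d) :
    sqrtOp M (sqrtOp M v) = Matrix.toEuclideanCLM (𝕜 := ℝ) M v := by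
  rw [sqrtOp, ← ContinuousLinearMap.comp_apply, ← ContinuousLinearMap.mul_def, ← map_mul,
    CFC.sqrt_mul_sqrt_self _ hM.nonneg]

theorem lintegral_inner_sq {μ : Measure (Vec d)} (hμ : MemLp id 2 μ) (v : Vec d) :
    ∫⁻ x, ENNReal.ofReal (inner ℝ v x ^ 2) ∂μ =
      ENNReal.ofReal (‖sqrtOp (secondMoment μ) v‖ ^ 2) := by
  rw [← ofReal_integral_eq_lintegral_ofReal (by simpa [sq] using integrable_inner_mul_inner hμ v v)
    (Filter.Eventually.of_forall fun _ => sq_nonneg _)]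
  simp_rw [sq (inner ℝ v _)]
  rw [integral_inner_mul_inner hμ, ← sqrtOp_sqrtOp (posSemidef_secondMoment hμ), ← inner_sqrtOp,
    real_inner_self_eq_norm_sq]

end SecondMoment

section Noiseless

variable {d n : ℕ} {P : Measure (Vec d)} [IsProbabilityMeasure P] {noise : Kernel (Vec d) ℝ}

/-- With zero conditional variance the noise vanishes almost surely. -/
theorem sampleLaw_of_noiseless (h : IsNoise P noise 0) (θ : Vec d) :
    sampleLaw P noise θ = P.map fun x => (x, inner ℝ x θ) := by
  have := h.markov
  have h0 : ∀ᵐ z ∂(P ⊗ₘ noise), z.2 = 0 := by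
    rw [Measure.ae_compProd_iff (measurableSet_eq_fun measurable_snd measurable_const)]
    filter_upwards [h.variance_eq] with x hx
    rw [ENNReal.ofReal_zero, lintegral_eq_zero_iff (by fun_prop)] at hx
    filter_upwards [hx] with e he
    simpa using he
  rw [sampleLaw, Measure.map_congr (g := (fun x => (x, inner ℝ x θ)) ∘ Prod.fst),
    ← Measure.map_map (by fun_prop) measurable_fst]
  · congr 1
    exact Measure.fst_compProd P noise
  · filter_upwards [h0] with z hz
    simp [hz]

theorem risk_of_noiseless (h : IsNoise P noise 0) (θ : Vec d) {f : Vec d → ℝ}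
    (hf : Measurable f) :
    risk P noise θ f = ∫⁻ x, ENNReal.ofReal ((inner ℝ x θ - f x) ^ 2) ∂P := by
  rw [risk, sampleLaw_of_noiseless h, lintegral_map (by fun_prop) (by fun_prop)]

/-- The residual `x - ∑ i, lᵢ(x) Xᵢ` of a linear prediction rule. -/
def LinearRule.residual (r : LinearRule d n) (x : Vec d) (X : Fin n → Vec d) (s : r.Seed) :
    Vec d :=
  x - ∑ i, r.weight x X s i • X i

theorem LinearRule.measurable_weight_apply (r : LinearRule d n) (i : Fin n) :
    Measurable fun p : Vec d × (Fin n → Vec d) × r.Seed => r.weight p.1 p.2.1 p.2.2 i :=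
  (measurable_pi_apply i).comp r.measurable_weight

theorem LinearRule.measurable_residual (r : LinearRule d n) :
    Measurable fun p : r.Seed × (Fin n → Vec d) × Vec d => r.residual p.2.2 p.2.1 p.1 := by
  refine (measurable_snd.comp measurable_snd).sub (Finset.measurable_sum _ fun i _ => ?_)
  have h : Measurable fun p : r.Seed × (Fin n → Vec d) × Vec d => r.weight p.2.2 p.2.1 p.1 i :=
    (r.measurable_weight_apply i).comp
      ((measurable_snd.comp measurable_snd).prodMk
        ((measurable_fst.comp measurable_snd).prodMk measurable_fst))
  exact h.smul (by fun_prop)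

theorem excessRisk_of_noiseless (h : IsNoise P noise 0) (θ : Vec d) (r : LinearRule d n) :
    excessRisk P noise θ r = ∫⁻ s, ∫⁻ X, ∫⁻ x,
      ENNReal.ofReal (inner ℝ (r.residual x X s) θ ^ 2) ∂P ∂(Measure.pi fun _ => P)
        ∂r.seedLaw := by
  have hbayes : risk P noise θ (fun x => inner ℝ x θ) = 0 := by
    rw [risk_of_noiseless h θ (by fun_prop)]
    simp
  rw [excessRisk, hbayes, tsub_zero]
  refine lintegral_congr fun s => ?_
  have hpred : Measurable fun p : (Fin n → Vec d × ℝ) × Vec d => r.predict p.1 s p.2 := by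
    refine Finset.measurable_sum _ fun i _ => Measurable.mul ?_ (by fun_prop)
    exact (r.measurable_weight_apply i).comp (measurable_snd.prodMk
      ((measurable_pi_iff.2 fun i => by fun_prop).prodMk measurable_const))
  have hrisk : ∀ D : Fin n → Vec d × ℝ, risk P noise θ (r.predict D s) =
      ∫⁻ x, ENNReal.ofReal ((inner ℝ x θ - r.predict D s x) ^ 2) ∂P := fun D =>
    risk_of_noiseless h θ (hpred.comp measurable_prodMk_left)
  simp_rw [hrisk, sampleLaw_of_noiseless h]
  have hmp : MeasurePreserving (fun (X : Fin n → Vec d) i => (X i, inner ℝ (X i) θ))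
      (Measure.pi fun _ => P) (Measure.pi fun _ => P.map fun x => (x, inner ℝ x θ)) := by
    have : IsProbabilityMeasure (P.map fun x : Vec d => (x, inner ℝ x θ)) :=
      Measure.isProbabilityMeasure_map (by fun_prop)
    exact measurePreserving_pi (fun _ => P) _ (f := fun _ x => (x, inner ℝ x θ))
      fun _ => ⟨by fun_prop, rfl⟩
  rw [← hmp.lintegral_comp]
  · refine lintegral_congr fun X => lintegral_congr fun x => ?_
    congr 2
    simp [LinearRule.predict, LinearRule.residual, inner_sub_left, sum_inner, inner_smul_left]
  · exact Measurable.lintegral_prod_right' (f := fun p : (Fin n → Vec d × ℝ) × Vec d =>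
      ENNReal.ofReal ((inner ℝ p.2 θ - r.predict p.1 s p.2) ^ 2)) (by fun_prop)

/-- Averaging over the parameter turns the excess risk into the mean squared length of the residual
in the metric given by the second moment of the parameter. -/
theorem lintegral_excessRisk {ν : Measure (Vec d)} [IsProbabilityMeasure ν]
    (hν : MemLp id 2 ν) (h : IsNoise P noise 0) (r : LinearRule d n) :
    ∫⁻ θ, excessRisk P noise θ r ∂ν = ∫⁻ s, ∫⁻ X, ∫⁻ x,
      ENNReal.ofReal (‖sqrtOp (secondMoment ν) (r.residual x X s)‖ ^ 2) ∂P
        ∂(Measure.pi fun _ => P) ∂r.seedLaw := by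
  have hres := r.measurable_residual
  have hunfold : ∀ F : r.Seed × (Fin n → Vec d) × Vec d → ℝ≥0∞, Measurable F →
      ∫⁻ s, ∫⁻ X, ∫⁻ x, F (s, X, x) ∂P ∂(Measure.pi fun _ => P) ∂r.seedLaw =
        ∫⁻ p, F p ∂(r.seedLaw.prod ((Measure.pi fun _ => P).prod P)) := by
    intro F hF
    rw [lintegral_prod _ hF.aemeasurable]
    refine lintegral_congr fun s => ?_
    rw [lintegral_prod (fun y => F (s, y)) (hF.comp measurable_prodMk_left).aemeasurable]
  calc ∫⁻ θ, excessRisk P noise θ r ∂ν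
      = ∫⁻ θ, ∫⁻ p, ENNReal.ofReal (inner ℝ (r.residual p.2.2 p.2.1 p.1) θ ^ 2)
          ∂(r.seedLaw.prod ((Measure.pi fun _ => P).prod P)) ∂ν := by
        refine lintegral_congr fun θ => ?_
        rw [excessRisk_of_noiseless h, ← hunfold _ (by fun_prop)]
    _ = ∫⁻ p, ∫⁻ θ, ENNReal.ofReal (inner ℝ (r.residual p.2.2 p.2.1 p.1) θ ^ 2) ∂ν
          ∂(r.seedLaw.prod ((Measure.pi fun _ => P).prod P)) := by
        refine lintegral_lintegral_swap (Measurable.aemeasurable ?_)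
        exact ENNReal.measurable_ofReal.comp
          (((hres.comp measurable_snd).inner measurable_fst).pow_const 2)
    _ = _ := by
        simp_rw [lintegral_inner_sq hν]
        rw [← hunfold (fun p => ENNReal.ofReal
          (‖sqrtOp (secondMoment ν) (r.residual p.2.2 p.2.1 p.1)‖ ^ 2)) (by fun_prop)]

end Noiseless

/-! ### Reduction to the diagonal problem -/

section Diagonalization

variable {d : ℕ}

/-- Vectors whose Gram matrix is diagonal are scaled vectors of an orthonormal basis. -/
theorem exists_orthonormalBasis_smul_eq {lam : Fin d → ℝ} (hlam : ∀ j, 0 ≤ lam j)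
    {c : Fin d → Vec d} (hc : ∀ i j, inner ℝ (c i) (c j) = if i = j then lam j else 0) :
    ∃ f : OrthonormalBasis (Fin d) ℝ (Vec d), ∀ j, c j = √(lam j) • f j := by
  have hv : Orthonormal ℝ ({j | 0 < lam j}.domRestrict fun j => (√(lam j))⁻¹ • c j) := by
    rw [orthonormal_iff_ite]
    rintro ⟨i, hi⟩ ⟨j, hj⟩
    have hj' := (Real.sqrt_pos.2 hj).ne'
    change inner ℝ ((√(lam i))⁻¹ • c i) ((√(lam j))⁻¹ • c j) = _
    rw [real_inner_smul_left, real_inner_smul_right, hc]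
    simp only [Subtype.mk.injEq]
    split_ifs with h
    · subst h
      have := Real.mul_self_sqrt (le_of_lt hj)
      field_simp
      rw [sq, this]
    · simp
  obtain ⟨f, hf⟩ := hv.exists_orthonormalBasis_extension_of_card_eq (by simp)
  refine ⟨f, fun j => ?_⟩
  rcases (hlam j).eq_or_lt with h | h
  · have := hc j j
    rw [if_pos rfl, ← h, inner_self_eq_zero] at this
    simp [this, ← h]
  · rw [hf j h, smul_smul, mul_inv_cancel₀ (Real.sqrt_pos.2 h).ne', one_smul]

theorem sqrtOp_latent {P : Measure (Vec d)} (hP : (secondMoment P).PosDef) (x : Vec d) :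
    sqrtOp (secondMoment P) (latent P x) = x := by
  have h : IsUnit (CFC.sqrt (secondMoment P)).det := by
    have h1 := congrArg Matrix.det
      (CFC.sqrt_mul_sqrt_self (secondMoment P) hP.posSemidef.nonneg)
    rw [Matrix.det_mul] at h1
    refine isUnit_iff_ne_zero.2 fun h0 => hP.det_pos.ne' ?_
    rw [← h1, h0, zero_mul]
  rw [sqrtOp, latent, ← ContinuousLinearMap.comp_apply, ← ContinuousLinearMap.mul_def, ← map_mul,
    Matrix.mul_nonsing_inv _ h, map_one]
  rfl

/-- In suitable orthonormal coordinates, `H^{1/2} x` is the diagonal scaling of the latent covariate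
by the square roots of the eigenvalues of `Σ_H`; in particular its coordinates are uncorrelated,
with the eigenvalues as second moments. The isometry `e` is given by an eigenbasis of `Σ_H`, and
`f` by normalizing the images of that basis under `Σ^{1/2} H^{1/2}`. -/
theorem exists_isometries {P ν : Measure (Vec d)} {S : Matrix (Fin d) (Fin d) ℝ}
    (hS : S.PosSemidef) (hP2 : MemLp id 2 P)
    (hP : (secondMoment P).PosDef) (hPν : sigmaH P ν = S) :
    ∃ e f : Vec d ≃ₗᵢ[ℝ] Vec d,
      (∀ x, e (sqrtOp (secondMoment ν) x) =
        scaled hS.isHermitian.eigenvalues (f (latent P x))) ∧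
      ∀ t, ∫⁻ x, ENNReal.ofReal (inner ℝ t (e (sqrtOp (secondMoment ν) x)) ^ 2) ∂P =
        ENNReal.ofReal (∑ k, hS.isHermitian.eigenvalues k * t k ^ 2) := by
  set lam := hS.isHermitian.eigenvalues with hlam
  have hlam0 : ∀ j, 0 ≤ lam j := hS.eigenvalues_nonneg
  set e := hS.isHermitian.eigenvectorBasis with he
  set A := sqrtOp (secondMoment P) with hA
  set B := sqrtOp (secondMoment ν) with hB
  have hBAAB : ∀ v, B (A (A (B v))) = Matrix.toEuclideanCLM (𝕜 := ℝ) S v := by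
    intro v
    rw [hA, sqrtOp_sqrtOp (posSemidef_secondMoment hP2), ← hPν, sigmaH, map_mul, map_mul]
    rfl
  have heig : ∀ j, Matrix.toEuclideanCLM (𝕜 := ℝ) S (e j) = lam j • e j := by
    intro j
    have := hS.isHermitian.mulVec_eigenvectorBasis j
    ext i
    simpa [Matrix.ofLp_toEuclideanCLM] using congrFun this i
  obtain ⟨f, hf⟩ := exists_orthonormalBasis_smul_eq hlam0 (c := fun j => A (B (e j))) (by
    intro i j
    rw [inner_sqrtOp, inner_sqrtOp, hBAAB, heig, inner_smul_right, e.inner_eq_ite]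
    simp)
  refine ⟨e.repr, f.repr, fun x => ?_, fun t => ?_⟩
  · ext j
    rw [scaled_apply, e.repr_apply_apply, f.repr_apply_apply, ← inner_sqrtOp,
      ← sqrtOp_latent hP x, ← inner_sqrtOp, hf, real_inner_smul_left, sqrtOp_latent hP]
  · have h1 : ∀ x, inner ℝ t (e.repr (B x)) = inner ℝ (B (e.repr.symm t)) x := by
      intro x
      rw [inner_sqrtOp, ← e.repr.inner_map_map (e.repr.symm t),
        LinearIsometryEquiv.apply_symm_apply]
    simp_rw [h1]
    rw [lintegral_inner_sq hP2, ← f.sum_sq_inner_right]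
    congr 1
    refine Finset.sum_congr rfl fun k _ => ?_
    have h2 : A (B (e.repr.symm t)) = ∑ k, (t k * √(lam k)) • f k := by
      rw [← e.sum_repr_symm]
      simp only [map_sum, map_smul, hf, smul_smul]
    rw [h2, inner_sum]
    simp [inner_smul_right, f.inner_eq_ite, mul_pow, Real.sq_sqrt (hlam0 k), mul_comm]

end Diagonalization

section Integration

variable {d n : ℕ} {P : Measure (Vec d)} {lam : Fin d → ℝ} {W : Vec d → Vec d}

/-- Whatever the coefficients, projecting onto the orthogonal complement of the span of `w` bounds
the residual from below; the mean of the projection depends only on the second moments of `W`. -/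
theorem sum_mul_distSq_le_lintegral (hW : Measurable W) (hlam : ∀ j, 0 ≤ lam j)
    (h : ∀ t, ∫⁻ x, ENNReal.ofReal (inner ℝ t (W x) ^ 2) ∂P =
      ENNReal.ofReal (∑ k, lam k * t k ^ 2)) (w : Fin n → Vec d) (l : Vec d → Fin n → ℝ) :
    ∑ j, ENNReal.ofReal (lam j) * distSq w (EuclideanSpace.single j 1) ≤
      ∫⁻ x, ENNReal.ofReal (‖W x - ∑ i, l x i • w i‖ ^ 2) ∂P := by
  set Q := (Submodule.span ℝ (Set.range w))ᗮ.starProjection with hQ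
  let s : Fin d → Vec d := fun k => EuclideanSpace.single k 1
  have hnorm : ∀ x : Vec d, ‖Q x‖ ^ 2 = ∑ k, inner ℝ (Q (s k)) x ^ 2 := by
    intro x
    rw [EuclideanSpace.real_norm_sq_eq]
    refine Finset.sum_congr rfl fun k _ => ?_
    rw [hQ, Submodule.inner_starProjection_left_eq_right, EuclideanSpace.inner_single_left]
    simp
  have hsymm : ∀ j k, Q (s k) j = Q (s j) k := by
    intro j k
    have h1 := Submodule.inner_starProjection_left_eq_right (Submodule.span ℝ (Set.range w))ᗮ
      (s j) (s k)
    simp only [s, EuclideanSpace.inner_single_left, EuclideanSpace.inner_single_right] at h1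
    simpa [hQ, s] using h1.symm
  calc ∑ j, ENNReal.ofReal (lam j) * distSq w (s j)
      = ∑ k, ENNReal.ofReal (∑ j, lam j * Q (s k) j ^ 2) := by
        simp_rw [distSq_eq_norm_sq]
        rw [← ENNReal.ofReal_sum_of_nonneg fun k _ => Finset.sum_nonneg fun j _ =>
          mul_nonneg (hlam j) (sq_nonneg _), Finset.sum_comm, ENNReal.ofReal_sum_of_nonneg
          fun j _ => Finset.sum_nonneg fun k _ => mul_nonneg (hlam j) (sq_nonneg _)]
        refine Finset.sum_congr rfl fun j _ => ?_
        rw [← ENNReal.ofReal_mul (hlam j), EuclideanSpace.real_norm_sq_eq, Finset.mul_sum]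
        simp_rw [hsymm j]
        rfl
    _ = ∑ k, ∫⁻ x, ENNReal.ofReal (inner ℝ (Q (s k)) (W x) ^ 2) ∂P := by simp_rw [h]
    _ = ∫⁻ x, ∑ k, ENNReal.ofReal (inner ℝ (Q (s k)) (W x) ^ 2) ∂P :=
        (lintegral_finsetSum _ fun k _ => by fun_prop).symm
    _ ≤ _ := by
        refine lintegral_mono fun x => ?_
        rw [← ENNReal.ofReal_sum_of_nonneg fun k _ => sq_nonneg _, ← hnorm,
          ← starProjection_orthogonal_sub_sum w (W x) (l x)]
        gcongr
        exact Submodule.norm_starProjection_apply_le _ _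

/-- As the coordinates of `W` are uncorrelated, the errors `V k` made on the coordinate vectors
contribute separately. -/
theorem lintegral_norm_sq_sum_smul (hW : Measurable W) (hlam : ∀ j, 0 ≤ lam j)
    (h : ∀ t, ∫⁻ x, ENNReal.ofReal (inner ℝ t (W x) ^ 2) ∂P =
      ENNReal.ofReal (∑ k, lam k * t k ^ 2)) (V : Fin d → Vec d) :
    ∫⁻ x, ENNReal.ofReal (‖∑ k, W x k • V k‖ ^ 2) ∂P =
      ∑ k, ENNReal.ofReal (lam k * ‖V k‖ ^ 2) := by
  have h1 : ∀ x, ENNReal.ofReal (‖∑ k, W x k • V k‖ ^ 2) =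
      ∑ j, ENNReal.ofReal (inner ℝ (WithLp.toLp 2 fun k => V k j : Vec d) (W x) ^ 2) := by
    intro x
    rw [EuclideanSpace.real_norm_sq_eq, ENNReal.ofReal_sum_of_nonneg fun _ _ => sq_nonneg _]
    simp [PiLp.inner_apply]
  rw [lintegral_congr h1, lintegral_finsetSum _ fun j _ => by fun_prop]
  simp_rw [h]
  rw [← ENNReal.ofReal_sum_of_nonneg fun j _ => Finset.sum_nonneg fun k _ =>
    mul_nonneg (hlam k) (sq_nonneg _), Finset.sum_comm,
    ENNReal.ofReal_sum_of_nonneg fun j _ => Finset.sum_nonneg fun k _ =>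
    mul_nonneg (hlam _) (sq_nonneg _)]
  simp_rw [EuclideanSpace.real_norm_sq_eq, Finset.mul_sum]

end Integration

/-- The direction of the latent covariate, in rotated coordinates; zero when the latent covariate
is zero. -/
noncomputable def latentDirection {d : ℕ} (P : Measure (Vec d)) (f : Vec d ≃ₗᵢ[ℝ] Vec d)
    (x : Vec d) : Vec d :=
  f (‖latent P x‖⁻¹ • latent P x)

theorem measurable_latent {d : ℕ} (P : Measure (Vec d)) : Measurable (latent P) :=
  ContinuousLinearMap.measurable _

theorem measurePreserving_latentDirection {d : ℕ} {P : Measure (Vec d)} (h : IsotropicLatent P)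
    (f : Vec d ≃ₗᵢ[ℝ] Vec d) :
    MeasurePreserving (latentDirection P f) P (uniformSphere d) :=
  MeasurePreserving.comp (g := f) ⟨f.continuous.measurable, uniformSphere_map f⟩
    ⟨measurable_direction.comp (measurable_latent P), h⟩

theorem measurePreserving_latentDirections {d : ℕ} (n : ℕ) (hd : 0 < d) {P : Measure (Vec d)}
    [IsProbabilityMeasure P] (h : IsotropicLatent P) (f : Vec d ≃ₗᵢ[ℝ] Vec d) :
    MeasurePreserving (fun (X : Fin n → Vec d) i => latentDirection P f (X i))
      (Measure.pi fun _ => P) (Measure.pi fun _ => uniformSphere d) := by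
  have := isProbabilityMeasure_uniformSphere hd
  exact measurePreserving_pi (fun _ => P) (fun _ => uniformSphere d)
    (f := fun _ => latentDirection P f) fun _ => measurePreserving_latentDirection h f

theorem smul_latentDirection {d : ℕ} (P : Measure (Vec d)) (f : Vec d ≃ₗᵢ[ℝ] Vec d) (x : Vec d) :
    ‖latent P x‖ • latentDirection P f x = f (latent P x) := by
  rw [latentDirection, map_smul, smul_smul]
  by_cases h : latent P x = 0
  · simp [h]
  · rw [mul_inv_cancel₀ (norm_ne_zero_iff.2 h), one_smul]

/-- No linear rule beats the projection of `H^{1/2} x` onto the span of the vectors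
`H^{1/2} Xᵢ`. -/
theorem meanSpanRisk_le_optimalRisk {n d : ℕ} (hd : 0 < d) {P ν : Measure (Vec d)}
    [IsProbabilityMeasure P] [IsProbabilityMeasure ν] {noise : Kernel (Vec d) ℝ}
    {S : Matrix (Fin d) (Fin d) ℝ} (hS : S.PosSemidef) (hP2 : MemLp id 2 P) (hν : MemLp id 2 ν)
    (hP : (secondMoment P).PosDef) (hiso : IsotropicLatent P) (hnoise : IsNoise P noise 0)
    (hPν : sigmaH P ν = S) :
    meanSpanRisk n hS.isHermitian.eigenvalues ≤ optimalRisk n P noise ν := by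
  obtain ⟨e, f, hef, hint⟩ := exists_isometries hS hP2 hP hPν
  set lam := hS.isHermitian.eigenvalues
  refine le_iInf fun r => ?_
  rw [lintegral_excessRisk hν hnoise r]
  have hmp := measurePreserving_latentDirections n hd hiso f
  have key : ∀ s, meanSpanRisk n lam ≤ ∫⁻ X, ∫⁻ x,
      ENNReal.ofReal (‖sqrtOp (secondMoment ν) (r.residual x X s)‖ ^ 2) ∂P
        ∂(Measure.pi fun _ => P) := by
    intro s
    rw [meanSpanRisk, ← hmp.lintegral_comp (measurable_spanRisk lam)]
    refine lintegral_mono fun X => ?_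
    refine le_trans (Finset.sum_le_sum fun j _ => ?_) ((sum_mul_distSq_le_lintegral (n := n)
      (by fun_prop) hS.eigenvalues_nonneg hint (fun i => e (sqrtOp (secondMoment ν) (X i)))
      fun x i => r.weight x X s i).trans (le_of_eq (lintegral_congr fun x => ?_)))
    · gcongr
      refine (distSq_le_smul _ _ fun i => ‖latent P (X i)‖).trans (le_of_eq ?_)
      simp_rw [← map_smul, smul_latentDirection, hef]
    · rw [← e.norm_map (sqrtOp _ (r.residual x X s)), LinearRule.residual]
      simp only [map_sub, map_sum, map_smul]
  calc meanSpanRisk n lam = ∫⁻ _, meanSpanRisk n lam ∂r.seedLaw := by simp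
    _ ≤ _ := lintegral_mono key

/-! ### A linear rule that attains the upper bound -/

/-- The second moment of an affine function of an empirical sum, as variance plus squared mean. -/
theorem integral_sq_affine_sum {d : ℕ} (hd : 0 < d) (n : ℕ) {f : Vec d → ℝ} (hf : Continuous f)
    (α β : ℝ) :
    Integrable (fun u : Fin n → Vec d => (α + β * ∑ i, f (u i)) ^ 2)
        (Measure.pi fun _ => uniformSphere d) ∧
      ∫ u : Fin n → Vec d, (α + β * ∑ i, f (u i)) ^ 2 ∂(Measure.pi fun _ => uniformSphere d) =
        β ^ 2 * (n * (∫ u, f u ^ 2 ∂(uniformSphere d) - (∫ u, f u ∂(uniformSphere d)) ^ 2)) +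
          (α + β * (n * ∫ u, f u ∂(uniformSphere d))) ^ 2 := by
  have := isProbabilityMeasure_uniformSphere hd
  have hf2 := memLp_two_uniformSphere hd hf
  have heval : ∀ i : Fin n, MemLp (fun u : Fin n → Vec d => f (u i)) 2
      (Measure.pi fun _ => uniformSphere d) := fun i =>
    hf2.comp_measurePreserving (measurePreserving_eval (fun _ : Fin n => uniformSphere d) i)
  have hsum : MemLp (fun u : Fin n → Vec d => ∑ i, f (u i)) 2
      (Measure.pi fun _ => uniformSphere d) := memLp_finsetSum _ fun i _ => heval i
  have hY : MemLp (fun u : Fin n → Vec d => α + β * ∑ i, f (u i)) 2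
      (Measure.pi fun _ => uniformSphere d) := (memLp_const α).add (hsum.const_mul β)
  refine ⟨hY.integrable_sq, ?_⟩
  have hmean : ∫ u : Fin n → Vec d, ∑ i, f (u i) ∂(Measure.pi fun _ => uniformSphere d) =
      n * ∫ u, f u ∂(uniformSphere d) := by
    rw [integral_finsetSum _ fun i _ => (heval i).integrable one_le_two]
    have h1 : ∀ i : Fin n, ∫ u : Fin n → Vec d, f (u i) ∂(Measure.pi fun _ => uniformSphere d) =
        ∫ u, f u ∂(uniformSphere d) := fun i =>
      integral_comp_eval (μ := fun _ : Fin n => uniformSphere d) hf.aestronglyMeasurable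
    simp [h1]
  have hvar := variance_sum_pi (μ := fun _ : Fin n => uniformSphere d) (X := fun _ => f)
    fun _ => hf2
  have hvar' : Var[fun u : Fin n → Vec d => α + β * ∑ i, f (u i);
      Measure.pi fun _ => uniformSphere d] = β ^ 2 * (n * Var[f; uniformSphere d]) := by
    rw [variance_const_add (hsum.const_mul β).aestronglyMeasurable, variance_const_mul]
    congr 1
    have hfn : (∑ i, fun u : Fin n → Vec d => f (u i)) = fun u => ∑ i, f (u i) := by
      ext u
      simp
    rw [← hfn, hvar]
    simp
  have hmeanY : ∫ u : Fin n → Vec d, (α + β * ∑ i, f (u i))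
      ∂(Measure.pi fun _ => uniformSphere d) = α + β * (n * ∫ u, f u ∂(uniformSphere d)) := by
    rw [integral_add (integrable_const _) ((hsum.const_mul β).integrable one_le_two),
      integral_const_mul, hmean]
    simp
  rw [variance_eq_sub hY, variance_eq_sub hf2, hmeanY] at hvar'
  simp only [Pi.pow_apply] at hvar'
  linarith

/-- The residual of one gradient step, with step size `a`, for the regression of the `k`-th
coordinate vector on the vectors `scaled lam (u i)`. -/
noncomputable def stepResidual {n d : ℕ} (lam : Fin d → ℝ) (a : ℝ) (k : Fin d)
    (u : Fin n → Vec d) : Vec d :=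
  EuclideanSpace.single k 1 - ∑ i, (a * √(lam k) * u i k) • scaled lam (u i)

theorem stepResidual_apply {n d : ℕ} (lam : Fin d → ℝ) (a : ℝ) (k j : Fin d)
    (u : Fin n → Vec d) : stepResidual lam a k u j =
      (if j = k then 1 else 0) + -(a * √(lam k) * √(lam j)) * ∑ i, u i k * u i j := by
  simp [stepResidual, scaled_apply, Finset.mul_sum, sub_eq_add_neg]
  exact Finset.sum_congr rfl fun i _ => by ring

/-- The second moment of a coordinate of the residual: the bias appears only for `j = k`, as
distinct coordinates are uncorrelated, and the fluctuation is governed by the fourth moments. -/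
theorem integral_sq_stepResidual_apply_le {n d : ℕ} (hd2 : 2 ≤ d) {lam : Fin d → ℝ}
    (hlam : ∀ j, 0 ≤ lam j) (a : ℝ) (k j : Fin d) :
    Integrable (fun u : Fin n → Vec d => stepResidual lam a k u j ^ 2)
        (Measure.pi fun _ => uniformSphere d) ∧
      ∫ u : Fin n → Vec d, stepResidual lam a k u j ^ 2 ∂(Measure.pi fun _ => uniformSphere d) ≤
        a ^ 2 * lam k * lam j * n / d ^ 2 +
          if j = k then a ^ 2 * lam k ^ 2 * n / d ^ 2 + (1 - a * lam k * n / d) ^ 2 else 0 := by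
  have hd : 0 < d := by omega
  simp_rw [stepResidual_apply]
  obtain ⟨h1, h2⟩ := integral_sq_affine_sum hd n (f := fun v : Vec d => v k * v j) (by fun_prop)
    (if j = k then 1 else 0) (-(a * √(lam k) * √(lam j)))
  refine ⟨h1, ?_⟩
  rw [h2]
  have hd' : (0 : ℝ) < d := by exact_mod_cast hd
  have hcoord : ∀ (v : Vec d) (j : Fin d), inner ℝ (EuclideanSpace.single j (1 : ℝ)) v = v j := by
    intro v j
    simp [EuclideanSpace.inner_single_left]
  have hβ : (-(a * √(lam k) * √(lam j))) ^ 2 = a ^ 2 * lam k * lam j := by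
    rw [neg_sq, mul_pow, mul_pow, Real.sq_sqrt (hlam k), Real.sq_sqrt (hlam j)]
  have hnorm : ∀ j : Fin d, ‖(EuclideanSpace.single j (1 : ℝ) : Vec d)‖ = 1 := by simp
  have hτ : 1 / ((d : ℝ) * (d + 2)) ≤ 1 / d ^ 2 :=
    one_div_le_one_div_of_le (by positivity) (by nlinarith)
  rw [hβ]
  by_cases hjk : j = k
  · subst hjk
    have m2 := integral_inner_sq_uniformSphere hd (hnorm j)
    simp_rw [hcoord] at m2
    obtain ⟨m4, hm4, hm4le⟩ : ∃ m4 : ℝ, ∫ u : Vec d, u j ^ 4 ∂(uniformSphere d) = m4 ∧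
        m4 ≤ 3 / d ^ 2 := by
      have : Nontrivial (Fin d) := Fin.nontrivial_iff_two_le.2 hd2
      obtain ⟨l, hl⟩ := exists_ne j
      have horth : inner ℝ (EuclideanSpace.single j (1 : ℝ) : Vec d)
          (EuclideanSpace.single l 1) = 0 := by
        rw [hcoord]; simp [hl.symm]
      have h4 := integral_inner_pow_four_eq hd (hnorm j) (hnorm l) horth
      rw [integral_inner_mul_inner_sq_uniformSphere hd (hnorm j) (hnorm l) horth] at h4
      simp_rw [hcoord] at h4
      refine ⟨_, h4, ?_⟩
      rw [show 3 / (d : ℝ) ^ 2 = 3 * (1 / d ^ 2) by ring]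
      gcongr
    have e1 : ∫ v : Vec d, v j * v j ∂(uniformSphere d) = 1 / d := by
      rw [← m2]; congr 1; ext v; ring
    have e2 : ∫ v : Vec d, (v j * v j) ^ 2 ∂(uniformSphere d) = m4 := by
      rw [← hm4]; congr 1; ext v; ring
    rw [e1, e2, if_pos rfl, if_pos rfl]
    have h3 : (1 + -(a * √(lam j) * √(lam j)) * (n * (1 / d))) = 1 - a * lam j * n / d := by
      rw [mul_assoc a, Real.mul_self_sqrt (hlam j)]; ring
    rw [h3]
    have h4 : a ^ 2 * lam j * lam j * (n * (m4 - (1 / d) ^ 2)) ≤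
        a ^ 2 * lam j * lam j * (n * (2 / d ^ 2)) := by
      have := hlam j
      gcongr
      have : (1 / (d : ℝ)) ^ 2 = 1 / d ^ 2 := by ring
      rw [this]
      have : 3 / (d : ℝ) ^ 2 - 1 / d ^ 2 = 2 / d ^ 2 := by ring
      linarith
    calc _ ≤ a ^ 2 * lam j * lam j * (n * (2 / d ^ 2)) + (1 - a * lam j * n / d) ^ 2 := by gcongr
      _ = _ := by ring
  · have horth : inner ℝ (EuclideanSpace.single k (1 : ℝ) : Vec d)
        (EuclideanSpace.single j 1) = 0 := by
      rw [hcoord]; simp [Ne.symm hjk]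
    have e1 := integral_inner_mul_inner_uniformSphere hd (hnorm k) (hnorm j) horth
    have e2 := integral_inner_mul_inner_sq_uniformSphere hd (hnorm k) (hnorm j) horth
    simp_rw [hcoord] at e1 e2
    rw [e1, e2, if_neg hjk, if_neg hjk]
    have := hlam j
    have := hlam k
    calc _ = a ^ 2 * lam k * lam j * n * (1 / (d * (d + 2))) := by ring
      _ ≤ a ^ 2 * lam k * lam j * n * (1 / d ^ 2) := by gcongr
      _ = _ := by ring

/-- With normalized step size `b = a * n / d`, the mean squared length of the residual is at most
`b ^ 2 * lam k * μ + (1 - b * lam k) ^ 2`, which is minimal for `b = 1 / (lam k + μ)`. -/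
theorem lintegral_norm_sq_stepResidual_le {n d : ℕ} (hn : 0 < n) (hd : 2 ≤ d) {lam : Fin d → ℝ}
    (hlam : ∀ j, 0 ≤ lam j) {μ : ℝ} (hμ : μ = 3 * (∑ j, lam j) / n) (k : Fin d) :
    ∫⁻ u : Fin n → Vec d, ENNReal.ofReal
        (lam k * ‖stepResidual lam (d / n / (lam k + μ)) k u‖ ^ 2)
        ∂(Measure.pi fun _ => uniformSphere d) ≤
      ENNReal.ofReal (lam k * (μ / (lam k + μ))) := by
  rcases (hlam k).eq_or_lt with h0 | hk
  · simp [← h0]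
  have hn' : (0 : ℝ) < n := by exact_mod_cast hn
  have hd' : (0 : ℝ) < d := by exact_mod_cast (show 0 < d by omega)
  have hkT : lam k ≤ ∑ j, lam j := Finset.single_le_sum (fun j _ => hlam j) (Finset.mem_univ k)
  have hμ0 : 0 < μ := by rw [hμ]; have := hk.trans_le hkT; positivity
  set b := 1 / (lam k + μ) with hb
  set a := d / n / (lam k + μ) with ha
  have hab : a * n / d = b := by rw [ha, hb]; field_simp
  have hint : ∀ j, _ := fun j => integral_sq_stepResidual_apply_le (n := n) hd hlam a k j
  have hsum : Integrable (fun u : Fin n → Vec d => lam k * ‖stepResidual lam a k u‖ ^ 2)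
      (Measure.pi fun _ => uniformSphere d) := by
    simp_rw [EuclideanSpace.real_norm_sq_eq]
    exact (integrable_finsetSum _ fun j _ => (hint j).1).const_mul _
  rw [← ofReal_integral_eq_lintegral_ofReal hsum
    (Filter.Eventually.of_forall fun u => mul_nonneg hk.le (sq_nonneg _))]
  apply ENNReal.ofReal_le_ofReal
  rw [integral_const_mul]
  gcongr
  simp_rw [EuclideanSpace.real_norm_sq_eq]
  rw [integral_finsetSum _ fun j _ => (hint j).1]
  calc _ ≤ ∑ j, (a ^ 2 * lam k * lam j * n / d ^ 2 +
        if j = k then a ^ 2 * lam k ^ 2 * n / d ^ 2 + (1 - a * lam k * n / d) ^ 2 else 0) :=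
        Finset.sum_le_sum fun j _ => (hint j).2
    _ = a ^ 2 * lam k * n / d ^ 2 * (∑ j, lam j) +
        (a ^ 2 * lam k ^ 2 * n / d ^ 2 + (1 - a * lam k * n / d) ^ 2) := by
        rw [Finset.sum_add_distrib, Finset.sum_ite_eq' Finset.univ k, Finset.mul_sum]
        simp only [Finset.mem_univ, if_true]
        congr 1
        exact Finset.sum_congr rfl fun j _ => by ring
    _ = b ^ 2 * lam k * ((∑ j, lam j + lam k) / n) + (1 - b * lam k) ^ 2 := by
        rw [← hab]
        field_simp
        ring
    _ ≤ b ^ 2 * lam k * μ + (1 - b * lam k) ^ 2 := by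
        gcongr
        rw [hμ]
        gcongr
        linarith
    _ = μ / (lam k + μ) := by
        rw [hb]
        field_simp
        ring

/-- The rule predicts the `k`-th coordinate of `H^{1/2} x` by one gradient step for each `k`, on the
training covariates divided by the norms of their latent vectors. -/
theorem optimalRisk_le {n d : ℕ} (hn : 0 < n) (hd : 2 ≤ d) {P ν : Measure (Vec d)}
    [IsProbabilityMeasure P] [IsProbabilityMeasure ν] {noise : Kernel (Vec d) ℝ}
    {S : Matrix (Fin d) (Fin d) ℝ} (hS : S.PosSemidef) (hP2 : MemLp id 2 P) (hν : MemLp id 2 ν)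
    (hP : (secondMoment P).PosDef) (hiso : IsotropicLatent P) (hnoise : IsNoise P noise 0)
    (hPν : sigmaH P ν = S) :
    optimalRisk n P noise ν ≤ ENNReal.ofReal (3 * S.trace / n * df1 S (3 * S.trace / n)) := by
  obtain ⟨e, f, hef, hint⟩ := exists_isometries hS hP2 hP hPν
  set lam := hS.isHermitian.eigenvalues
  have hlam0 : ∀ j, 0 ≤ lam j := hS.eigenvalues_nonneg
  have htr : S.trace = ∑ j, lam j := by
    simpa using hS.isHermitian.trace_eq_sum_eigenvalues
  obtain ⟨μ, hμ⟩ : ∃ μ : ℝ, μ = 3 * (∑ j, lam j) / n := ⟨_, rfl⟩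
  have hμ0 : 0 ≤ μ := by
    rw [hμ]
    have := Finset.sum_nonneg fun j (_ : j ∈ Finset.univ) => hlam0 j
    positivity
  have hmp := measurePreserving_latentDirections n (by omega) hiso f
  let B := sqrtOp (secondMoment ν)
  let c : (Fin n → Vec d) → Fin n → Fin d → ℝ := fun X i k =>
    d / n / (lam k + μ) * √(lam k) * latentDirection P f (X i) k
  have hlat : ∀ x, ‖latent P x‖⁻¹ • e (B x) = scaled lam (latentDirection P f x) := by
    intro x
    rw [hef, latentDirection, map_smul, map_smul]
  let r : LinearRule d n :=
    { Seed := Unit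
      seedLaw := Measure.dirac ()
      weight := fun x X _ i => ∑ k, e (B x) k * c X i k * ‖latent P (X i)‖⁻¹
      measurable_weight := by
        have h1 := (measurePreserving_latentDirection hiso f).measurable
        have h2 := measurable_latent P
        have h3 : ∀ k, Measurable fun x : Vec d => x k := fun k => by fun_prop
        refine measurable_pi_iff.2 fun i => Finset.measurable_sum _ fun k _ => ?_
        have h4 : Measurable fun p : Vec d × (Fin n → Vec d) × Unit => p.2.1 i := by fun_prop
        refine (Measurable.mul ?_ ?_).mul (h2.comp h4).norm.inv
        · exact (h3 k).comp ((e.continuous.measurable.comp B.measurable).comp measurable_fst)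
        · exact ((h3 k).comp (h1.comp h4)).const_mul _ }
  have hres : ∀ x X s, e (B (r.residual x X s)) = ∑ k, e (B x) k •
      stepResidual lam (d / n / (lam k + μ)) k fun i => latentDirection P f (X i) := by
    intro x X s
    have h1 : e (B x) = ∑ k, e (B x) k • (EuclideanSpace.single k 1 : Vec d) := by
      ext j
      simp [Pi.single_apply]
    simp only [LinearRule.residual, stepResidual, map_sub, map_sum, map_smul, smul_sub,
      Finset.sum_sub_distrib, ← h1]
    congr 1
    simp_rw [Finset.smul_sum]
    rw [Finset.sum_comm]
    refine Finset.sum_congr rfl fun i _ => ?_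
    simp only [r, Finset.sum_smul]
    refine Finset.sum_congr rfl fun k _ => ?_
    rw [mul_smul, hlat, smul_smul]
  refine (iInf_le _ r).trans ?_
  rw [lintegral_excessRisk hν hnoise r]
  have hinner : ∀ s X, ∫⁻ x, ENNReal.ofReal (‖B (r.residual x X s)‖ ^ 2) ∂P =
      ∑ k, ENNReal.ofReal (lam k * ‖stepResidual lam (d / n / (lam k + μ)) k
        fun i => latentDirection P f (X i)‖ ^ 2) := by
    intro s X
    rw [← lintegral_norm_sq_sum_smul (by fun_prop) hlam0 hint]
    refine lintegral_congr fun x => ?_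
    rw [← e.norm_map, hres]
  have hmeas : ∀ k, Measurable fun u : Fin n → Vec d => ENNReal.ofReal
      (lam k * ‖stepResidual lam (d / n / (lam k + μ)) k u‖ ^ 2) := by
    intro k
    unfold stepResidual
    fun_prop
  calc _ = ∫⁻ _s, ∫⁻ u, ∑ k, ENNReal.ofReal (lam k * ‖stepResidual lam
          (d / n / (lam k + μ)) k u‖ ^ 2) ∂(Measure.pi fun _ => uniformSphere d) ∂r.seedLaw := by
        refine lintegral_congr fun s => ?_
        rw [← hmp.lintegral_comp (Finset.measurable_sum _ fun k _ => hmeas k)]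
        exact lintegral_congr fun X => hinner s X
    _ = ∑ k, ∫⁻ u, ENNReal.ofReal (lam k * ‖stepResidual lam
          (d / n / (lam k + μ)) k u‖ ^ 2) ∂(Measure.pi fun _ : Fin n => uniformSphere d) := by
        rw [lintegral_const, measure_univ, mul_one, lintegral_finsetSum _ fun k _ => hmeas k]
    _ ≤ ∑ k, ENNReal.ofReal (lam k * (μ / (lam k + μ))) :=
        Finset.sum_le_sum fun k _ => lintegral_norm_sq_stepResidual_le hn hd hlam0 hμ k
    _ = ENNReal.ofReal (3 * S.trace / n * df1 S (3 * S.trace / n)) := by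
        rw [htr, ← hμ, mul_df1_eq hS hμ0, ENNReal.ofReal_sum_of_nonneg fun k _ =>
          mul_nonneg (hlam0 k) (div_nonneg hμ0 (add_nonneg (hlam0 k) hμ0))]

end LinearPrediction

theorem mainTheorem3 (n d : ℕ) (hn : 0 < n) (hd : n + 2 < d)
    (S : Matrix (Fin d) (Fin d) ℝ) (hS : S.PosSemidef) :
    ∃ σ₀sq : ℝ,
      0 ≤ σ₀sq ∧
      (n < S.rank → 0 < σ₀sq) ∧
      (∀ k : ℕ, n + 2 < k → k ≤ d → 0 < eig hS.isHermitian k →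
        ((k : ℝ) - 1) * ((k : ℝ) - n - 2) *
            (∑ j ∈ Finset.Icc 2 k, (eig hS.isHermitian j)⁻¹)⁻¹ ≤ σ₀sq) ∧
      ∀ (P ν : Measure (Vec d)) [IsProbabilityMeasure P] [IsProbabilityMeasure ν]
        (noise : Kernel (Vec d) ℝ),
        MemLp id 2 P → MemLp id 2 ν → (secondMoment P).PosDef → IsotropicLatent P →
        IsNoise P noise 0 → sigmaH P ν = S →
        ENNReal.ofReal (σ₀sq / n * df1 S (σ₀sq / n)) ≤ optimalRisk n P noise ν ∧
        optimalRisk n P noise ν ≤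
          ENNReal.ofReal (3 * S.trace / n * df1 S (3 * S.trace / n)) := by
  obtain ⟨σ₀sq, h0, hpos, hk, hle⟩ := exists_noise_level hn hd hS
  refine ⟨σ₀sq, h0, hpos, hk, fun P ν _ _ noise hP2 hν hP hiso hnoise hPν => ⟨?_, ?_⟩⟩
  · exact hle.trans (meanSpanRisk_le_optimalRisk (by omega) hS hP2 hν hP hiso hnoise hPν)
  · exact optimalRisk_le hn (by omega) hS hP2 hν hP hiso hnoise hPν
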